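/- Let $C$ be an $[[n,k,d]]$ qubit stabilizer code with $k<n$, with independent stabilizer generators $g_1,\dots,g_{n-k}$ and logical operators $X_L^{(1)},Z_L^{(1)},\dots,X_L^{(k)},Z_L^{(k)}$. A pair $(g,g')$ of Hermitian elements of the $n$-qubit Pauli group is called a code rewiring pair for the generator $g_m$ (where $g_m$ is any one of the generators) if $g$ and $g'$ each commute with all $g_j$, $j\neq m$, and anticommute with $g_m$, if $g$ commutes with all the logical operators $X_L^{(j)},Z_L^{(j)}$, and if $g$ and $g'$ anticommute. The corresponding elementary code rewiring consists of three measure-and-correct steps: measure $g$ and apply $g_m$ if the outcome is $-1$; measure $g'$ and apply $g$ if the outcome is $-1$; measure $g_m$ and apply $g'$ if the outcome is $-1$. Then every logical Clifford operator $U$ on $C$ (that is, every unitary operator on the code space that conjugates every logical Pauli operator to a logical Pauli operator) can be induced by a finite sequence of elementary code rewirings: there is a finite sequence of elementary code rewirings such that, whatever the measurement outcomes are, every state $|\psi\rangle$ of the code space is taken to $U|\psi\rangle$, up to normalization and a global phase that does not depend on $|\psi\rangle$. -/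

import Mathlib

namespace CodeRewiring

/-- The Hilbert space of `n` qubits; the computational basis is indexed by bit strings. -/
abbrev Qubits (n : ℕ) : Type := EuclideanSpace ℂ (Fin n → Fin 2)

/-- Operators on `n` qubits, as matrices in the computational basis. -/
abbrev Op (n : ℕ) : Type := Matrix (Fin n → Fin 2) (Fin n → Fin 2) ℂ

/-- The operator `A 0 ⊗ A 1 ⊗ ⋯ ⊗ A (n - 1)`. -/
def tensor {n : ℕ} (A : Fin n → Matrix (Fin 2) (Fin 2) ℂ) : Op n :=
  Matrix.of fun s t => ∏ j, A j (s j) (t j)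

/-- `X_a`: the Pauli matrix `X` on the qubits `j` with `a j = 1`. -/
def pauliX {n : ℕ} (a : Fin n → ZMod 2) : Op n :=
  tensor fun j => if a j = 1 then !![0, 1; 1, 0] else 1

/-- `Z_b`: the Pauli matrix `Z` on the qubits `j` with `b j = 1`. -/
def pauliZ {n : ℕ} (b : Fin n → ZMod 2) : Op n :=
  tensor fun j => if b j = 1 then !![1, 0; 0, -1] else 1

/-- Membership in the `n`-qubit Pauli group `{ i ^ c X_a Z_b }`. -/
def IsPauli {n : ℕ} (P : Op n) : Prop :=
  ∃ (c : ℕ) (a b : Fin n → ZMod 2), P = Complex.I ^ c • (pauliX a * pauliZ b)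

/-- A Pauli observable: a Hermitian element of the Pauli group. -/
def IsPauliObservable {n : ℕ} (P : Op n) : Prop :=
  IsPauli P ∧ P.IsHermitian

/-- `A` and `B` anticommute. -/
def Anticommute {n : ℕ} (A B : Op n) : Prop :=
  A * B = -(B * A)

/-- The number of qubits on which `X_a Z_b` acts nontrivially. -/
def pauliWeight {n : ℕ} (a b : Fin n → ZMod 2) : ℕ :=
  (Finset.univ.filter fun j => a j ≠ 0 ∨ b j ≠ 0).card

/-- A stabilizer code with `n` physical and `k` logical qubits, presented by `n - k` independent
commuting generators of a stabilizer group: a subgroup of the Pauli group not containing `-1`.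
(Elements of the Pauli group have finite order, so the submonoid generated by some of them is the
subgroup generated by them.) -/
structure StabilizerCode (n k : ℕ) where
  /-- the stabilizer generators -/
  gen : Fin (n - k) → Op n
  isPauli : ∀ i, IsPauli (gen i)
  commute : ∀ i j, Commute (gen i) (gen j)
  neg_one_notMem : (-1 : Op n) ∉ Submonoid.closure (Set.range gen)
  independent : ∀ i, gen i ∉ Submonoid.closure (gen '' {i}ᶜ)

namespace StabilizerCode

variable {n k : ℕ} (C : StabilizerCode n k)

/-- The stabilizer group. -/
def stabilizer : Submonoid (Op n) := Submonoid.closure (Set.range C.gen)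

/-- The code space: the joint `+1` eigenspace of the stabilizer generators. -/
noncomputable def space : Submodule ℂ (Qubits n) :=
  ⨅ i, LinearMap.eqLocus (Matrix.toEuclideanLin (C.gen i)) LinearMap.id

/-- The logical Pauli operators: the elements of the Pauli group that commute with every
stabilizer generator. -/
def IsLogicalPauli (P : Op n) : Prop :=
  IsPauli P ∧ ∀ i, Commute P (C.gen i)

/-- The distance: the least weight of an element of the Pauli group that commutes with the
stabilizer but is not, up to a phase, in the stabilizer (`⊤` if there is no such element, which
happens for `k = 0`). -/
noncomputable def distance : ℕ∞ :=
  ⨅ (a : Fin n → ZMod 2) (b : Fin n → ZMod 2)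
    (_ : C.IsLogicalPauli (pauliX a * pauliZ b) ∧
      ∀ c : ℕ, Complex.I ^ c • (pauliX a * pauliZ b) ∉ C.stabilizer),
    (pauliWeight a b : ℕ∞)

theorem mem_space {v : Qubits n} :
    v ∈ C.space ↔ ∀ i, Matrix.toEuclideanLin (C.gen i) v = v := by
  simp [space, Submodule.mem_iInf]

theorem IsLogicalPauli.mapsTo {C : StabilizerCode n k} {P : Op n} (hP : C.IsLogicalPauli P) :
    ∀ v ∈ C.space, Matrix.toEuclideanLin P v ∈ C.space := by
  intro v hv
  rw [mem_space] at hv ⊢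
  intro i
  conv_rhs => rw [← hv i]
  simp only [Matrix.toLpLin_apply, Matrix.mulVec_mulVec, (hP.2 i).eq]

/-- The operator on the code space given by a logical Pauli operator. -/
noncomputable def act {P : Op n} (hP : C.IsLogicalPauli P) : C.space →ₗ[ℂ] C.space :=
  (Matrix.toEuclideanLin P).restrict hP.mapsTo

/-- A logical Clifford operator: a unitary operator `U` on the code space such that `U P U⁻¹` is
(the restriction of) a logical Pauli operator for every logical Pauli operator `P`. -/
def IsClifford (U : C.space ≃ₗᵢ[ℂ] C.space) : Prop :=
  ∀ (P : Op n) (hP : C.IsLogicalPauli P), ∃ (Q : Op n) (hQ : C.IsLogicalPauli Q),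
    ∀ v : C.space, U (C.act hP (U.symm v)) = C.act hQ v

/-- A choice of logical operators `X_L^(j)`, `Z_L^(j)` for the `k` encoded qubits: logical Pauli
observables with the commutation relations of the single-qubit `X` and `Z` operators. -/
structure LogicalBasis where
  X : Fin k → Op n
  Z : Fin k → Op n
  X_observable : ∀ j, IsPauliObservable (X j)
  Z_observable : ∀ j, IsPauliObservable (Z j)
  X_gen : ∀ j i, Commute (X j) (C.gen i)
  Z_gen : ∀ j i, Commute (Z j) (C.gen i)
  X_X : ∀ j l, Commute (X j) (X l)
  Z_Z : ∀ j l, Commute (Z j) (Z l)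
  X_Z_ne : ∀ j l, j ≠ l → Commute (X j) (Z l)
  X_Z_self : ∀ j, Anticommute (X j) (Z j)

/-- `(g, g')` is a code rewiring pair for the stabilizer generator with index `m` (an arbitrary
one of the generators). -/
structure IsRewiringPair (L : C.LogicalBasis) (m : Fin (n - k)) (g g' : Op n) : Prop where
  observable : IsPauliObservable g
  observable' : IsPauliObservable g'
  commute_gen : ∀ j, j ≠ m → Commute g (C.gen j)
  anticommute_gen : Anticommute g (C.gen m)
  commute_X : ∀ j, Commute g (L.X j)
  commute_Z : ∀ j, Commute g (L.Z j)
  commute_gen' : ∀ j, j ≠ m → Commute g' (C.gen j)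
  anticommute_gen' : Anticommute g' (C.gen m)
  anticommute : Anticommute g g'

end StabilizerCode

/-- A measure-and-correct step: measure the observable `obs`, and apply `corr` if the outcome
is `-1`. -/
structure Step (n : ℕ) where
  obs : Op n
  corr : Op n

/-- The (unnormalized) effect of a step on state vectors. Outcome `+1` is `false`: project with
`(1 + obs) / 2`. Outcome `-1` is `true`: project with `(1 - obs) / 2`, then apply `corr`. -/
noncomputable def Step.branch {n : ℕ} (p : Step n) : Bool → Op n
  | false => (1 / 2 : ℂ) • (1 + p.obs)
  | true => p.corr * ((1 / 2 : ℂ) • (1 - p.obs))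

/-- The (unnormalized) effect on state vectors of performing the steps of a list one after
another, the head of the list first, when each step has the outcome it is paired with. -/
noncomputable def run {n : ℕ} : List (Step n × Bool) → Op n
  | [] => 1
  | x :: xs => run xs * x.1.branch x.2

namespace StabilizerCode

variable {n k : ℕ} (C : StabilizerCode n k)

/-- The list of steps `ps` induces the operator `U` on the code space: for every sequence of
measurement outcomes, every state `v` of the code space ends as `U v`, up to a nonzero scalar which
does not depend on `v` (the probability amplitude of the outcomes times a global phase). -/
def Induces (ps : List (Step n)) (U : C.space ≃ₗᵢ[ℂ] C.space) : Prop :=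
  ∀ outcomes : List Bool, outcomes.length = ps.length →
    ∃ z : ℂ, z ≠ 0 ∧ ∀ v : C.space,
      Matrix.toEuclideanLin (run (ps.zip outcomes)) (v : Qubits n) = z • (U v : Qubits n)

/-- An elementary code rewiring of `C` is given by a stabilizer generator and a code rewiring pair
for it. -/
structure ElementaryRewiring (L : C.LogicalBasis) where
  m : Fin (n - k)
  g : Op n
  g' : Op n
  isPair : C.IsRewiringPair L m g g'

/-- The three steps of an elementary code rewiring: measure `g`, correcting with `g_m`; measure
`g'`, correcting with `g`; measure `g_m`, correcting with `g'`. -/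
def ElementaryRewiring.steps {C : StabilizerCode n k} {L : C.LogicalBasis}
    (r : C.ElementaryRewiring L) : List (Step n) :=
  [⟨r.g, C.gen r.m⟩, ⟨r.g', r.g⟩, ⟨C.gen r.m, r.g'⟩]

end StabilizerCode

end CodeRewiring

/-!
The proof identifies a rewiring with a rotation on the code space and then shows that these
rotations generate the logical Clifford group.

**The effect of a rewiring.** In each of the three steps the correction fixes the current state and
anticommutes with the measured observable, so both outcomes leave the state projected onto the `+1`
eigenspace (`Step.branch_apply`). On the code space the product of the three projections is
`(1 + g' g) / 4` (`ElementaryRewiring.run_apply`). As `g` and `g'` anticommute, `g' g = i P` with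
`P` a Hermitian Pauli operator commuting with the stabilizer, so this is a multiple of the rotation
`exp (i π P / 4)`.

**Every rotation occurs.** Elements of the Pauli group are labelled, up to a phase, by vectors over
`𝔽₂`, and commutation is a nondegenerate symplectic form on the labels. The labels of the generators
and of the logical operators are linearly independent, so some Pauli operator `g` anticommutes with
`g_m` and commutes with all the others (`exists_symp_eq`). A logical observable is represented by a
product `R` of logical operators; then `R g_m` represents it too and anticommutes with `g`, so that
`(g, i R g_m g)` is a rewiring pair with the rotation `1 + i R`
(`LogicalBasis.exists_elementaryRewiring`).

**Rotations generate the Clifford group.** For anticommuting observables `V` and `Q`, the rotation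
about `i V Q` conjugates `V` to `Q` and fixes whatever commutes with `V Q`. At most two rotations
return the image of `X_L^(r)` to `X_L^(r)`, and two more that of `Z_L^(r)`, without disturbing the
pairs treated before (`IsQubitFrame.induction_clifford`); these rotations are the transvections of
the symplectic group. What remains commutes with all logical operators. It is a scalar, because
averaging over conjugation by the logical Pauli operators leaves only the Pauli components in the
stabilizer (`LogicalBasis.exists_eq_smul_one`).
-/

namespace CodeRewiring

/-! ### The Pauli operators and the symplectic form -/

/-- The vectors `(a, b)` over `𝔽₂` that label the Pauli operators `X_a Z_b`. -/
abbrev PauliVec (n : ℕ) : Type := (Fin n → ZMod 2) × (Fin n → ZMod 2)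

/-- The Pauli operator `X_a Z_b` with label `v = (a, b)`. It need not be Hermitian. -/
def pauli {n : ℕ} (v : PauliVec n) : Op n := pauliX v.1 * pauliZ v.2

/-- The sign `(-1) ^ x` of `x : 𝔽₂`. -/
def sgn (x : ZMod 2) : ℂ := if x = 0 then 1 else -1

@[simp] theorem sgn_zero : sgn 0 = 1 := rfl

@[simp] theorem sgn_one : sgn 1 = -1 := if_neg (by decide)

theorem zmod_two_cases (x : ZMod 2) : x = 0 ∨ x = 1 := by
  revert x; decide

theorem sgn_add (x y : ZMod 2) : sgn (x + y) = sgn x * sgn y := by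
  have h : (1 + 1 : ZMod 2) = 0 := by decide
  rcases zmod_two_cases x with rfl | rfl <;> rcases zmod_two_cases y with rfl | rfl <;> simp [h]

@[simp] theorem sgn_mul_self (x : ZMod 2) : sgn x * sgn x = 1 := by
  rcases zmod_two_cases x with rfl | rfl <;> simp

theorem sgn_sum {ι : Type*} (s : Finset ι) (f : ι → ZMod 2) :
    sgn (∑ i ∈ s, f i) = ∏ i ∈ s, sgn (f i) := by
  classical
  induction s using Finset.induction_on with
  | empty => simp
  | insert i s hi ih => rw [Finset.sum_insert hi, Finset.prod_insert hi, sgn_add, ih]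

section Tensor

variable {n : ℕ}

theorem tensor_mul (A B : Fin n → Matrix (Fin 2) (Fin 2) ℂ) :
    tensor A * tensor B = tensor fun j => A j * B j := by
  ext s t
  simp only [tensor, Matrix.mul_apply, Matrix.of_apply]
  rw [Finset.prod_univ_sum]
  simp [Finset.prod_mul_distrib, Fintype.piFinset_univ]

theorem tensor_smul (c : Fin n → ℂ) (A : Fin n → Matrix (Fin 2) (Fin 2) ℂ) :
    (tensor fun j => c j • A j) = (∏ j, c j) • tensor A := by
  ext s t
  simp [tensor, Finset.prod_mul_distrib]

theorem tensor_one : tensor (fun _ : Fin n => 1) = 1 := by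
  ext s t
  simp only [tensor, Matrix.of_apply, Matrix.one_apply, Finset.prod_boole]
  simp [funext_iff]

theorem tensor_conjTranspose (A : Fin n → Matrix (Fin 2) (Fin 2) ℂ) :
    (tensor A).conjTranspose = tensor fun j => (A j).conjTranspose := by
  ext s t
  simp [tensor, Matrix.conjTranspose_apply]

theorem pauliX_mul (a a' : Fin n → ZMod 2) : pauliX a * pauliX a' = pauliX (a + a') := by
  rw [pauliX, pauliX, tensor_mul, pauliX]
  congr 1
  funext j
  have h : (1 + 1 : ZMod 2) = 0 := by decide
  rcases zmod_two_cases (a j) with h1 | h1 <;> rcases zmod_two_cases (a' j) with h2 | h2 <;>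
    simp [h1, h2, h, Matrix.one_fin_two]

theorem pauliZ_mul (b b' : Fin n → ZMod 2) : pauliZ b * pauliZ b' = pauliZ (b + b') := by
  rw [pauliZ, pauliZ, tensor_mul, pauliZ]
  congr 1
  funext j
  have h : (1 + 1 : ZMod 2) = 0 := by decide
  rcases zmod_two_cases (b j) with h1 | h1 <;> rcases zmod_two_cases (b' j) with h2 | h2 <;>
    simp [h1, h2, h, Matrix.one_fin_two]

theorem pauliZ_mul_pauliX (a b : Fin n → ZMod 2) :
    pauliZ b * pauliX a = sgn (b ⬝ᵥ a) • (pauliX a * pauliZ b) := by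
  rw [pauliX, pauliZ, tensor_mul, tensor_mul, dotProduct, sgn_sum, ← tensor_smul]
  congr 1
  funext j
  rcases zmod_two_cases (a j) with h1 | h1 <;> rcases zmod_two_cases (b j) with h2 | h2 <;>
    simp [h1, h2]

theorem pauliX_conjTranspose (a : Fin n → ZMod 2) : (pauliX a).conjTranspose = pauliX a := by
  rw [pauliX, tensor_conjTranspose]
  congr 1
  funext j
  split_ifs <;> ext i k <;> fin_cases i <;> fin_cases k <;> simp [Matrix.conjTranspose_apply]

theorem pauliZ_conjTranspose (b : Fin n → ZMod 2) : (pauliZ b).conjTranspose = pauliZ b := by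
  rw [pauliZ, tensor_conjTranspose]
  congr 1
  funext j
  split_ifs <;> ext i k <;> fin_cases i <;> fin_cases k <;> simp [Matrix.conjTranspose_apply]

@[simp] theorem pauli_zero : pauli (0 : PauliVec n) = 1 := by
  simp [pauli, pauliX, pauliZ, tensor_one]

theorem pauli_mul (v w : PauliVec n) :
    pauli v * pauli w = sgn (v.2 ⬝ᵥ w.1) • pauli (v + w) := by
  have : pauli v * pauli w = pauliX v.1 * (pauliZ v.2 * pauliX w.1) * pauliZ w.2 := by
    simp only [pauli, mul_assoc]
  rw [this, pauliZ_mul_pauliX, pauli, Prod.fst_add, Prod.snd_add, ← pauliX_mul, ← pauliZ_mul]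
  simp only [mul_smul_comm, smul_mul_assoc, mul_assoc]

theorem pauli_conjTranspose (v : PauliVec n) :
    (pauli v).conjTranspose = sgn (v.2 ⬝ᵥ v.1) • pauli v := by
  rw [pauli, Matrix.conjTranspose_mul, pauliX_conjTranspose, pauliZ_conjTranspose,
    pauliZ_mul_pauliX]

theorem add_self_pauliVec (v : PauliVec n) : v + v = 0 := by
  ext j <;> exact CharTwo.add_self_eq_zero _

theorem pauli_mul_self (v : PauliVec n) : pauli v * pauli v = sgn (v.2 ⬝ᵥ v.1) • 1 := by
  rw [pauli_mul, add_self_pauliVec, pauli_zero]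

/-- The symplectic form on the labels of Pauli operators: two Pauli operators commute if and only
if the form vanishes on their labels. -/
def symp (n : ℕ) : LinearMap.BilinForm (ZMod 2) (PauliVec n) :=
  LinearMap.mk₂ (ZMod 2) (fun v w => v.2 ⬝ᵥ w.1 + w.2 ⬝ᵥ v.1)
    (fun v v' w => by simp only [Prod.fst_add, Prod.snd_add, add_dotProduct, dotProduct_add]; ring)
    (fun c v w => by
      simp only [Prod.smul_fst, Prod.smul_snd, smul_dotProduct, dotProduct_smul, smul_add])
    (fun v w w' => by
      simp only [Prod.fst_add, Prod.snd_add, add_dotProduct, dotProduct_add]; ring)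
    (fun c v w => by
      simp only [Prod.smul_fst, Prod.smul_snd, smul_dotProduct, dotProduct_smul, smul_add])

theorem symp_apply (v w : PauliVec n) : symp n v w = v.2 ⬝ᵥ w.1 + w.2 ⬝ᵥ v.1 := rfl

theorem symp_comm (v w : PauliVec n) : symp n v w = symp n w v := by
  rw [symp_apply, symp_apply, add_comm]

theorem symp_isRefl : (symp n).IsRefl := fun v w h => by rw [symp_comm, h]

theorem symp_nondegenerate : (symp n).Nondegenerate := by
  refine (LinearMap.IsRefl.nondegenerate_iff_separatingLeft symp_isRefl).2 ?_
  intro v hv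
  ext j
  · simpa [symp_apply] using hv (0, Pi.single j 1)
  · simpa [symp_apply] using hv (Pi.single j 1, 0)

theorem pauli_mul_comm (v w : PauliVec n) :
    pauli v * pauli w = sgn (symp n v w) • (pauli w * pauli v) := by
  rw [pauli_mul, pauli_mul, symp_apply, sgn_add, smul_smul, mul_assoc, sgn_mul_self, mul_one,
    add_comm w v]

theorem pauli_add (v w : PauliVec n) :
    pauli (v + w) = sgn (v.2 ⬝ᵥ w.1) • (pauli v * pauli w) := by
  rw [pauli_mul, smul_smul, sgn_mul_self, one_smul]

/-- Every `2 × 2` matrix is a combination of the matrices `1`, `X`, `Z`, `XZ`; expanding the tensor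
products of matrix units then shows that the Pauli operators span all operators. -/
theorem span_pauli : Submodule.span ℂ (Set.range (pauli (n := n))) = ⊤ := by
  rw [eq_top_iff]
  rintro M -
  let σ : ZMod 2 × ZMod 2 → Matrix (Fin 2) (Fin 2) ℂ := fun q =>
    (if q.1 = 1 then !![0, 1; 1, 0] else 1) * (if q.2 = 1 then !![1, 0; 0, -1] else 1)
  have hσ : ∀ x y : Fin 2, ∃ c : ZMod 2 × ZMod 2 → ℂ, ∀ i l,
      (if i = x ∧ l = y then 1 else 0 : ℂ) = ∑ q, c q * σ q i l := by
    intro x y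
    -- `Z^0` and `Z^1` combine to the projector onto `y`, and `X^(x + y)` moves `y` to `x`.
    refine ⟨fun q => (1 / 2) * (if q.1 = 1 ↔ x ≠ y then 1 else 0) *
      (if q.2 = 1 ∧ y = 1 then -1 else 1), fun i l => ?_⟩
    have hu : (Finset.univ : Finset (ZMod 2)) = {0, 1} := by decide
    have h01 : (0 : ZMod 2) ≠ 1 := by decide
    rw [Fintype.sum_prod_type]
    simp only [hu, Finset.sum_pair h01, σ]
    fin_cases x <;> fin_cases y <;> fin_cases i <;> fin_cases l <;>
      norm_num [h01, Matrix.one_apply]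
  choose c hc using hσ
  have key : ∀ s t : Fin n → Fin 2,
      Matrix.single s t (1 : ℂ) = ∑ f : Fin n → ZMod 2 × ZMod 2,
        (∏ j, c (s j) (t j) (f j)) • pauli (fun j => (f j).1, fun j => (f j).2) := by
    intro s t
    ext i l
    have h1 : Matrix.single s t (1 : ℂ) i l = ∏ j, if i j = s j ∧ l j = t j then (1 : ℂ) else 0 := by
      rw [Finset.prod_boole, Matrix.single_apply]
      simp [funext_iff, forall_and, eq_comm]
    rw [h1, Finset.prod_congr rfl fun j _ => hc _ _ _ _, Finset.prod_univ_sum,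
      Fintype.piFinset_univ, Matrix.sum_apply]
    refine Finset.sum_congr rfl fun f _ => ?_
    rw [Finset.prod_mul_distrib, Matrix.smul_apply, smul_eq_mul, pauli, pauliX, pauliZ, tensor_mul]
    rfl
  rw [Matrix.matrix_eq_sum_single M]
  refine Submodule.sum_mem _ fun s _ => Submodule.sum_mem _ fun t _ => ?_
  rw [← mul_one (M s t), ← smul_eq_mul, ← Matrix.smul_single, key]
  exact Submodule.smul_mem _ _ (Submodule.sum_mem _ fun f _ =>
    Submodule.smul_mem _ _ (Submodule.subset_span ⟨_, rfl⟩))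

end Tensor

/-! ### Clifford operators are products of quarter-turn rotations -/

section Anticommutation

variable {A : Type*} [Ring A]

theorem commute_of_anticommute {a b c : A} (h1 : a * c = -(c * a)) (h2 : b * c = -(c * b)) :
    Commute (a * b) c := by
  change a * b * c = c * (a * b)
  rw [mul_assoc, h2, mul_neg, ← mul_assoc, h1, neg_mul, neg_neg, mul_assoc]

theorem anticommute_mul_of_commute {a b c : A} (h1 : a * c = -(c * a)) (h2 : Commute b c) :
    (a * b) * c = -(c * (a * b)) := by
  rw [mul_assoc, h2.eq, ← mul_assoc, h1, neg_mul, mul_assoc]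

theorem commute_mul_anticommute {a b c : A} (h1 : Commute a c) (h2 : b * c = -(c * b)) :
    (a * b) * c = -(c * (a * b)) := by
  rw [mul_assoc, h2, mul_neg, ← mul_assoc, h1.eq, mul_assoc]

theorem anticommute_symm {a b : A} (h : a * b = -(b * a)) : b * a = -(a * b) := by
  rw [h, neg_neg]

theorem mul_mul_self_of_anticommute {a b : A} (ha : a * a = 1) (hb : b * b = 1)
    (h : a * b = -(b * a)) : a * b * (a * b) = -1 := by
  nth_rewrite 1 [h]
  rw [neg_mul, mul_assoc, ← mul_assoc a a b, ha, one_mul, hb]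

theorem units_conj_mul (U : Aˣ) (a b : A) :
    (U : A) * a * (U⁻¹ : Aˣ) * ((U : A) * b * (U⁻¹ : Aˣ)) = (U : A) * (a * b) * (U⁻¹ : Aˣ) := by
  simp only [mul_assoc, Units.inv_mul_cancel_left]

theorem units_conj_commute {U : Aˣ} {a b : A} (hb : (U : A) * b * (U⁻¹ : Aˣ) = b)
    (h : Commute a b) : Commute ((U : A) * a * (U⁻¹ : Aˣ)) b := by
  rw [← hb]
  change _ * _ = _ * _
  rw [units_conj_mul, units_conj_mul, h.eq]

theorem units_conj_anticommute {U : Aˣ} {a b : A} (hb : (U : A) * b * (U⁻¹ : Aˣ) = b)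
    (h : a * b = -(b * a)) :
    (U : A) * a * (U⁻¹ : Aˣ) * b = -(b * ((U : A) * a * (U⁻¹ : Aˣ))) := by
  have h1 := units_conj_mul U a b
  have h2 := units_conj_mul U b a
  rw [hb] at h1 h2
  rw [h1, h2, h, mul_neg, neg_mul]

end Anticommutation

section Rotation

variable {A : Type*} [Ring A] [Algebra ℂ A]

/-- A set of observables that behaves like the Hermitian Pauli operators: involutions, any two of
which commute or anticommute, closed under products up to the factor `i` that makes the product
of two anticommuting involutions an involution. -/
structure IsPauliFamily (Obs : Set A) : Prop where
  mul_self : ∀ P ∈ Obs, P * P = 1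
  commute_or : ∀ P ∈ Obs, ∀ Q ∈ Obs, Commute P Q ∨ P * Q = -(Q * P)
  mul_mem : ∀ P ∈ Obs, ∀ Q ∈ Obs, Commute P Q → P * Q ∈ Obs
  I_smul_mul_mem : ∀ P ∈ Obs, ∀ Q ∈ Obs, P * Q = -(Q * P) → Complex.I • (P * Q) ∈ Obs

theorem one_add_I_smul_mul_one_sub {R : A} (hR : R * R = 1) :
    (1 + Complex.I • R) * (1 - Complex.I • R) = (2 : ℂ) • 1 := by
  simp only [mul_sub, add_mul, mul_one, one_mul, smul_mul_smul_comm, hR, Complex.I_mul_I]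
  module

theorem one_sub_I_smul_mul_one_add {R : A} (hR : R * R = 1) :
    (1 - Complex.I • R) * (1 + Complex.I • R) = (2 : ℂ) • 1 := by
  simp only [mul_add, sub_mul, mul_one, one_mul, smul_mul_smul_comm, hR, Complex.I_mul_I]
  module

/-- The multiple `1 + i R` of the rotation `exp (i π R / 4)` about an involution `R`. -/
noncomputable def rotation (R : A) (hR : R * R = 1) : Aˣ where
  val := 1 + Complex.I • R
  inv := (1 / 2 : ℂ) • (1 - Complex.I • R)
  val_inv := by
    rw [mul_smul_comm, one_add_I_smul_mul_one_sub hR, smul_smul]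
    norm_num
  inv_val := by
    rw [smul_mul_assoc, one_sub_I_smul_mul_one_add hR, smul_smul]
    norm_num

theorem rotation_conj_of_commute {R : A} (hR : R * R = 1) {Q : A} (h : Commute R Q) :
    (rotation R hR : A) * Q * ((rotation R hR)⁻¹ : Aˣ) = Q := by
  have : Commute (rotation R hR : A) Q := (Commute.one_left Q).add_left (h.smul_left _)
  rw [this.eq, mul_assoc, Units.mul_inv, mul_one]

theorem rotation_conj_of_anticommute {R : A} (hR : R * R = 1) {Q : A} (h : R * Q = -(Q * R)) :
    (rotation R hR : A) * Q * ((rotation R hR)⁻¹ : Aˣ) = Complex.I • (R * Q) := by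
  rw [Units.mul_inv_eq_iff_eq_mul]
  change (1 + Complex.I • R) * Q = Complex.I • (R * Q) * (1 + Complex.I • R)
  have h2 : R * Q * R = -Q := by
    rw [h, neg_mul, mul_assoc, hR, mul_one]
  simp only [add_mul, mul_add, one_mul, mul_one, smul_mul_assoc, mul_smul_comm, h2, smul_neg,
    smul_smul, Complex.I_mul_I]
  module

/-- Conjugation by `U` maps the family `Obs` into itself. -/
def PreservesFamily (Obs : Set A) (U : Aˣ) : Prop :=
  ∀ P ∈ Obs, (U : A) * P * (U⁻¹ : Aˣ) ∈ Obs

variable {Obs : Set A} {Ind : A → Prop}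

/-- If `V` and `Q` anticommute, the rotation about `i V Q` takes `V` to `Q` and fixes whatever
commutes with `V Q`. It can be appended to `U` without changing whether `U` is inducible, since
the opposite rotation is about `i Q V`. -/
theorem exists_rotation_to (hObs : IsPauliFamily Obs)
    (Ind_smul : ∀ (c : ℂ) (T : A), c ≠ 0 → Ind T → Ind (c • T))
    (Ind_rotation : ∀ P ∈ Obs, ∀ T, Ind T → Ind ((1 + Complex.I • P) * T))
    {U : Aˣ} (hU : PreservesFamily Obs U) {V Q : A} (hV : V ∈ Obs) (hQ : Q ∈ Obs)
    (hVQ : V * Q = -(Q * V)) :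
    ∃ U' : Aˣ, PreservesFamily Obs U' ∧ (Ind U' → Ind U) ∧
      (∀ b, (U : A) * b * (U⁻¹ : Aˣ) = V → (U' : A) * b * (U'⁻¹ : Aˣ) = Q) ∧
      ∀ b, Commute (V * Q) ((U : A) * b * (U⁻¹ : Aˣ)) →
        (U' : A) * b * (U'⁻¹ : Aˣ) = (U : A) * b * (U⁻¹ : Aˣ) := by
  set R : A := Complex.I • (V * Q) with hRdef
  have hRmem : R ∈ Obs := hObs.I_smul_mul_mem V hV Q hQ hVQ
  have hR : R * R = 1 := hObs.mul_self R hRmem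
  have hconj : ∀ b, ((rotation R hR * U : Aˣ) : A) * b * ((rotation R hR * U)⁻¹ : Aˣ) =
      (rotation R hR : A) * ((U : A) * b * (U⁻¹ : Aˣ)) * ((rotation R hR)⁻¹ : Aˣ) := by
    intro b
    simp only [mul_inv_rev, Units.val_mul, mul_assoc]
  refine ⟨rotation R hR * U, ?_, ?_, ?_, ?_⟩
  · intro P hP
    rw [hconj]
    have hB := hU P hP
    rcases hObs.commute_or R hRmem _ hB with h | h
    · rwa [rotation_conj_of_commute hR h]
    · rw [rotation_conj_of_anticommute hR h]
      exact hObs.I_smul_mul_mem R hRmem _ hB h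
  · intro h
    have hneg : -R ∈ Obs := by
      have h1 : Q * V = -(V * Q) := by rw [hVQ, neg_neg]
      have h2 := hObs.I_smul_mul_mem Q hQ V hV h1
      rwa [h1, smul_neg] at h2
    have h3 := Ind_smul (1 / 2) _ (by norm_num) (Ind_rotation _ hneg _ h)
    convert h3 using 1
    rw [Units.val_mul, ← mul_assoc, smul_neg, ← sub_eq_add_neg]
    change _ = (1 / 2 : ℂ) • ((1 - Complex.I • R) * (1 + Complex.I • R) * (U : A))
    rw [one_sub_I_smul_mul_one_add hR, smul_mul_assoc, smul_smul, one_mul]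
    norm_num
  · intro b hb
    have hVV := hObs.mul_self V hV
    have h1 : R * V = -(V * R) := by
      rw [hRdef, smul_mul_assoc, mul_smul_comm, ← smul_neg]
      congr 1
      rw [mul_assoc V Q V, ← mul_neg, hVQ, neg_neg]
    rw [hconj, hb, rotation_conj_of_anticommute hR h1, hRdef, smul_mul_assoc, smul_smul,
      Complex.I_mul_I, hVQ, neg_mul, mul_assoc, hVV, mul_one, neg_one_smul, neg_neg]
  · intro b hb
    rw [hconj, rotation_conj_of_commute hR (hb.smul_left _)]

theorem smul_anticommute {a b : A} (c : ℂ) (h : a * b = -(b * a)) :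
    (c • a) * b = -(b * (c • a)) := by
  rw [smul_mul_assoc, mul_smul_comm, h, smul_neg]

/-- The observables `X j`, `Z j` are those of `k` qubits: members of `Obs` with the usual
commutation relations, and only scalars commute with all of them. -/
structure IsQubitFrame {k : ℕ} (Obs : Set A) (X Z : Fin k → A) : Prop where
  X_mem : ∀ j, X j ∈ Obs
  Z_mem : ∀ j, Z j ∈ Obs
  X_X : ∀ j l, Commute (X j) (X l)
  Z_Z : ∀ j l, Commute (Z j) (Z l)
  X_Z_ne : ∀ j l, j ≠ l → Commute (X j) (Z l)
  X_Z_self : ∀ j, X j * Z j = -(Z j * X j)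
  scalar : ∀ T, (∀ j, Commute T (X j)) → (∀ j, Commute T (Z j)) → ∃ c : ℂ, T = c • 1

variable {k : ℕ} {X Z : Fin k → A}

/-- If the image `V` of `X r` commutes with `X r`, with `Z r` and with the pairs outside
`insert r t`, then some observable anticommutes with both `V` and `X r` and also commutes with those
pairs. As `V` is not a scalar, it anticommutes with some `X j` or `Z j`, and the observable is `Z r`
times that. -/
theorem IsQubitFrame.exists_anticommute [Nontrivial A] (hObs : IsPauliFamily Obs)
    (hF : IsQubitFrame Obs X Z) {U : Aˣ} {V : A} {r : Fin k} (hV : V ∈ Obs)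
    (hUV : (U : A) * X r * (U⁻¹ : Aˣ) = V) (hVX : Commute V (X r)) (hVZ : Commute V (Z r))
    (t : Finset (Fin k))
    (ht : ∀ j ∉ insert r t, Commute V (X j) ∧ Commute V (Z j)) :
    ∃ R ∈ Obs, V * R = -(R * V) ∧ R * X r = -(X r * R) ∧
      ∀ j ∉ insert r t, Commute R (X j) ∧ Commute R (Z j) := by
  -- If `V` commuted with everything, it would be a scalar, and so would its conjugate `X r`.
  have hns : ¬ ((∀ j, Commute V (X j)) ∧ ∀ j, Commute V (Z j)) := by
    rintro ⟨h1, h2⟩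
    obtain ⟨c, hc⟩ := hF.scalar V h1 h2
    have hX : X r = c • 1 := by
      rw [hc, Units.mul_inv_eq_iff_eq_mul, smul_mul_assoc, one_mul] at hUV
      have := congrArg (fun a => ((U⁻¹ : Aˣ) : A) * a) hUV
      simpa only [mul_smul_comm, Units.inv_mul, Units.inv_mul_cancel_left] using this
    have h3 := hF.X_Z_self r
    have h4 := hObs.mul_self _ (hF.Z_mem r)
    have h5 := hObs.mul_self _ (hF.X_mem r)
    rw [hX, smul_mul_assoc, mul_smul_comm, one_mul, mul_one] at h3
    rw [hX, smul_mul_smul_comm, one_mul] at h5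
    have h6 : (2 : ℂ) • (c • Z r) = 0 := by
      rw [two_smul]; nth_rewrite 1 [h3]; exact neg_add_cancel _
    have h7 : c • Z r = 0 := (smul_eq_zero.1 h6).resolve_left two_ne_zero
    have h8 : (1 : A) = (c • Z r) * (c • Z r) := by
      rw [smul_mul_smul_comm, h4, h5]
    rw [h7, mul_zero] at h8
    exact one_ne_zero h8
  have key : ∀ j, ∀ S ∈ Obs, j ≠ r → Commute S (X r) → Commute S (Z r) →
      (∀ l ≠ j, Commute S (X l) ∧ Commute S (Z l)) → V * S = -(S * V) → j ∈ insert r t →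
      ∃ R ∈ Obs, V * R = -(R * V) ∧ R * X r = -(X r * R) ∧
        ∀ j ∉ insert r t, Commute R (X j) ∧ Commute R (Z j) := by
    intro j S hS hjr hSX hSZ hSl hVS hj
    refine ⟨Z r * S, hObs.mul_mem _ (hF.Z_mem r) _ hS hSZ.symm, ?_, ?_, ?_⟩
    · exact anticommute_symm (commute_mul_anticommute hVZ.symm (anticommute_symm hVS))
    · exact anticommute_mul_of_commute (anticommute_symm (hF.X_Z_self r)) hSX
    · intro l hl
      have hlj : l ≠ j := fun h => hl (h ▸ hj)
      have hlr : l ≠ r := fun h => hl (h ▸ Finset.mem_insert_self _ _)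
      exact ⟨(hF.X_Z_ne l r hlr).symm.mul_left (hSl l hlj).1,
        (hF.Z_Z r l).mul_left (hSl l hlj).2⟩
  by_cases h1 : ∀ j, Commute V (X j)
  · have h2 : ¬ ∀ j, Commute V (Z j) := fun h => hns ⟨h1, h⟩
    push Not at h2
    obtain ⟨j, hj⟩ := h2
    have hjr : j ≠ r := by rintro rfl; exact hj hVZ
    exact key j (Z j) (hF.Z_mem j) hjr (hF.X_Z_ne r j hjr.symm).symm (hF.Z_Z j r)
      (fun l hl => ⟨(hF.X_Z_ne l j hl).symm, hF.Z_Z j l⟩)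
      ((hObs.commute_or V hV _ (hF.Z_mem j)).resolve_left hj)
      (by by_contra h; exact hj (ht j h).2)
  · push Not at h1
    obtain ⟨j, hj⟩ := h1
    have hjr : j ≠ r := by rintro rfl; exact hj hVX
    exact key j (X j) (hF.X_mem j) hjr (hF.X_X j r) (hF.X_Z_ne j r hjr)
      (fun l hl => ⟨hF.X_X j l, hF.X_Z_ne j l hl.symm⟩)
      ((hObs.commute_or V hV _ (hF.X_mem j)).resolve_left hj)
      (by by_contra h; exact hj (ht j h).1)

/-- Rotations generate the Clifford group: a property of operators that is stable under nonzero
scalars and under rotations `1 + i P` holds for every Clifford operator. At most four rotations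
make `U` fix one more pair `X r`, `Z r`; an operator that fixes all pairs is a scalar. -/
theorem IsQubitFrame.induction_clifford [Nontrivial A] (hObs : IsPauliFamily Obs)
    (hF : IsQubitFrame Obs X Z) (Ind_one : Ind 1)
    (Ind_smul : ∀ (c : ℂ) (T : A), c ≠ 0 → Ind T → Ind (c • T))
    (Ind_rotation : ∀ P ∈ Obs, ∀ T, Ind T → Ind ((1 + Complex.I • P) * T))
    (U : Aˣ) (hU : PreservesFamily Obs U) : Ind U := by
  suffices H : ∀ t : Finset (Fin k), ∀ U : Aˣ, PreservesFamily Obs U →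
      (∀ j ∉ t, (U : A) * X j * (U⁻¹ : Aˣ) = X j ∧ (U : A) * Z j * (U⁻¹ : Aˣ) = Z j) → Ind U from
    H Finset.univ U hU fun j hj => absurd (Finset.mem_univ j) hj
  intro t
  induction t using Finset.induction_on with
  | empty =>
    intro U _ hfix
    obtain ⟨c, hc⟩ := hF.scalar U
      (fun j => (Units.mul_inv_eq_iff_eq_mul _).1 (hfix j (Finset.notMem_empty j)).1)
      (fun j => (Units.mul_inv_eq_iff_eq_mul _).1 (hfix j (Finset.notMem_empty j)).2)
    rw [hc]
    refine Ind_smul c 1 ?_ Ind_one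
    rintro rfl
    rw [zero_smul] at hc
    exact U.ne_zero hc
  | insert r t hr ih =>
    have rot := fun {U : Aˣ} => exists_rotation_to (U := U) hObs Ind_smul Ind_rotation
    have fixed : ∀ {U U' : Aˣ} {a : A},
        (∀ j ∉ insert r t,
          (U : A) * X j * (U⁻¹ : Aˣ) = X j ∧ (U : A) * Z j * (U⁻¹ : Aˣ) = Z j) →
        (∀ b, Commute a ((U : A) * b * (U⁻¹ : Aˣ)) →
          (U' : A) * b * (U'⁻¹ : Aˣ) = (U : A) * b * (U⁻¹ : Aˣ)) →
        (∀ j ∉ insert r t, Commute a (X j) ∧ Commute a (Z j)) →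
        ∀ j ∉ insert r t,
          (U' : A) * X j * (U'⁻¹ : Aˣ) = X j ∧ (U' : A) * Z j * (U'⁻¹ : Aˣ) = Z j := by
      intro U U' a hfix hU' ha j hj
      have h1 := hfix j hj
      have h2 := ha j hj
      have h3 := hU' (X j) (by rw [h1.1]; exact h2.1)
      have h4 := hU' (Z j) (by rw [h1.2]; exact h2.2)
      exact ⟨h3.trans h1.1, h4.trans h1.2⟩
    have hne : ∀ {j}, j ∉ insert r t → j ≠ r := fun hj h => hj (h ▸ Finset.mem_insert_self _ _)
    have hX : ∀ j ∉ insert r t, Commute (X r) (X j) ∧ Commute (X r) (Z j) := fun j hj =>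
      ⟨hF.X_X r j, hF.X_Z_ne r j (hne hj).symm⟩
    have hZ : ∀ j ∉ insert r t, Commute (Z r) (X j) ∧ Commute (Z r) (Z j) := fun j hj =>
      ⟨(hF.X_Z_ne j r (hne hj)).symm, hF.Z_Z r j⟩
    have hZX := anticommute_symm (hF.X_Z_self r)
    -- `X r` is fixed, and the image of `Z r` anticommutes with `Z r`: one rotation fixes `Z r`.
    have fix_Z_of_anticommute : ∀ U : Aˣ, PreservesFamily Obs U →
        (∀ j ∉ insert r t,
          (U : A) * X j * (U⁻¹ : Aˣ) = X j ∧ (U : A) * Z j * (U⁻¹ : Aˣ) = Z j) →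
        (U : A) * X r * (U⁻¹ : Aˣ) = X r →
        (U : A) * Z r * (U⁻¹ : Aˣ) * Z r = -(Z r * ((U : A) * Z r * (U⁻¹ : Aˣ))) → Ind U := by
      intro U hU hfix hUX hV
      obtain ⟨U', hU', hInd, hto, hcom⟩ := rot hU (hU _ (hF.Z_mem r)) (hF.Z_mem r) hV
      refine hInd (ih U' hU' fun j hj => ?_)
      by_cases hjr : j = r
      · subst hjr
        refine ⟨(hcom _ ?_).trans hUX, hto _ rfl⟩
        rw [hUX]
        exact commute_of_anticommute (units_conj_anticommute hUX hZX) hZX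
      · have hj' : j ∉ insert r t := by simp [hjr, hj]
        refine fixed hfix hcom (fun l hl => ⟨?_, ?_⟩) j hj'
        · exact (units_conj_commute (hfix l hl).1 (hZ l hl).1).mul_left (hZ l hl).1
        · exact (units_conj_commute (hfix l hl).2 (hZ l hl).2).mul_left (hZ l hl).2
    -- Otherwise the image of `Z r` first goes to `i X r Z r`, which anticommutes with both.
    have fix_Z : ∀ U : Aˣ, PreservesFamily Obs U →
        (∀ j ∉ insert r t,
          (U : A) * X j * (U⁻¹ : Aˣ) = X j ∧ (U : A) * Z j * (U⁻¹ : Aˣ) = Z j) →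
        (U : A) * X r * (U⁻¹ : Aˣ) = X r → Ind U := by
      intro U hU hfix hUX
      rcases hObs.commute_or _ (hU _ (hF.Z_mem r)) _ (hF.Z_mem r) with h | h
      swap
      · exact fix_Z_of_anticommute U hU hfix hUX h
      have hVX := units_conj_anticommute hUX hZX
      have hVY : (U : A) * Z r * (U⁻¹ : Aˣ) * (Complex.I • (X r * Z r)) =
          -(Complex.I • (X r * Z r) * ((U : A) * Z r * (U⁻¹ : Aˣ))) :=
        anticommute_symm (smul_anticommute _
          (anticommute_mul_of_commute (anticommute_symm hVX) h.symm))
      obtain ⟨U', hU', hInd, hto, hcom⟩ := rot hU (hU _ (hF.Z_mem r))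
        (hObs.I_smul_mul_mem _ (hF.X_mem r) _ (hF.Z_mem r) (hF.X_Z_self r)) hVY
      have hYX : Complex.I • (X r * Z r) * X r = -(X r * (Complex.I • (X r * Z r))) :=
        smul_anticommute _ (commute_mul_anticommute (Commute.refl _) hZX)
      refine hInd (fix_Z_of_anticommute U' hU' (fixed hfix hcom fun l hl => ⟨?_, ?_⟩) ?_ ?_)
      · exact (units_conj_commute (hfix l hl).1 (hZ l hl).1).mul_left
          (((hX l hl).1.mul_left (hZ l hl).1).smul_left _)
      · exact (units_conj_commute (hfix l hl).2 (hZ l hl).2).mul_left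
          (((hX l hl).2.mul_left (hZ l hl).2).smul_left _)
      · refine (hcom _ ?_).trans hUX
        rw [hUX]
        exact commute_of_anticommute hVX hYX
      · rw [hto _ rfl]
        exact smul_anticommute _ (anticommute_mul_of_commute (hF.X_Z_self r) (Commute.refl _))
    -- The image of `X r` anticommutes with `X r`: one rotation fixes `X r`.
    have fix_X_of_anticommute : ∀ U : Aˣ, PreservesFamily Obs U →
        (∀ j ∉ insert r t,
          (U : A) * X j * (U⁻¹ : Aˣ) = X j ∧ (U : A) * Z j * (U⁻¹ : Aˣ) = Z j) →
        (U : A) * X r * (U⁻¹ : Aˣ) * X r = -(X r * ((U : A) * X r * (U⁻¹ : Aˣ))) → Ind U := by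
      intro U hU hfix hV
      obtain ⟨U', hU', hInd, hto, hcom⟩ := rot hU (hU _ (hF.X_mem r)) (hF.X_mem r) hV
      refine hInd (fix_Z U' hU' (fixed hfix hcom fun l hl => ⟨?_, ?_⟩) (hto _ rfl))
      · exact (units_conj_commute (hfix l hl).1 (hX l hl).1).mul_left (hX l hl).1
      · exact (units_conj_commute (hfix l hl).2 (hX l hl).2).mul_left (hX l hl).2
    -- Otherwise the image of `X r` first goes to an observable that anticommutes with both.
    intro U hU hfix
    have hV := hU _ (hF.X_mem r)
    rcases hObs.commute_or _ hV _ (hF.X_mem r) with hVX | hVX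
    swap
    · exact fix_X_of_anticommute U hU hfix hVX
    have hVt : ∀ j ∉ insert r t, Commute ((U : A) * X r * (U⁻¹ : Aˣ)) (X j) ∧
        Commute ((U : A) * X r * (U⁻¹ : Aˣ)) (Z j) := fun j hj =>
      ⟨units_conj_commute (hfix j hj).1 (hX j hj).1, units_conj_commute (hfix j hj).2 (hX j hj).2⟩
    obtain ⟨R, hR, hVR, hRX, hRt⟩ : ∃ R ∈ Obs,
        (U : A) * X r * (U⁻¹ : Aˣ) * R = -(R * ((U : A) * X r * (U⁻¹ : Aˣ))) ∧
        R * X r = -(X r * R) ∧ ∀ j ∉ insert r t, Commute R (X j) ∧ Commute R (Z j) := by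
      rcases hObs.commute_or _ hV _ (hF.Z_mem r) with hVZ | hVZ
      · exact hF.exists_anticommute hObs hV rfl hVX hVZ t hVt
      · exact ⟨Z r, hF.Z_mem r, hVZ, hZX, hZ⟩
    obtain ⟨U', hU', hInd, hto, hcom⟩ := rot hU hV hR hVR
    refine hInd (fix_X_of_anticommute U' hU' (fixed hfix hcom fun l hl => ⟨?_, ?_⟩) ?_)
    · exact (hVt l hl).1.mul_left (hRt l hl).1
    · exact (hVt l hl).2.mul_left (hRt l hl).2
    · rw [hto _ rfl]
      exact hRX

end Rotation

/-! ### Elements of the Pauli group and their labels -/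

section PauliGroup

variable {n : ℕ}

theorem toEuclideanLin_mul_apply (M N : Op n) (x : Qubits n) :
    Matrix.toEuclideanLin (M * N) x = Matrix.toEuclideanLin M (Matrix.toEuclideanLin N x) := by
  simp only [Matrix.toLpLin_apply, Matrix.mulVec_mulVec]

theorem toEuclideanLin_one_apply (x : Qubits n) :
    Matrix.toEuclideanLin (1 : Op n) x = x := by
  simp only [Matrix.toLpLin_apply, Matrix.one_mulVec]

theorem exists_sgn_eq_I_pow (x : ZMod 2) : ∃ e : ℕ, sgn x = Complex.I ^ e := by
  rcases zmod_two_cases x with rfl | rfl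
  · exact ⟨0, by simp⟩
  · exact ⟨2, by simp⟩

theorem I_pow_mul_I_pow_three_mul (c : ℕ) : Complex.I ^ (3 * c) * Complex.I ^ c = 1 := by
  rw [← pow_add, show 3 * c + c = 4 * c by ring, pow_mul, Complex.I_pow_four, one_pow]

theorem I_pow_ne_zero (c : ℕ) : Complex.I ^ c ≠ 0 := pow_ne_zero _ Complex.I_ne_zero

theorem isPauli_iff {P : Op n} :
    IsPauli P ↔ ∃ (c : ℕ) (v : PauliVec n), P = Complex.I ^ c • pauli v :=
  ⟨fun ⟨c, a, b, h⟩ => ⟨c, (a, b), h⟩, fun ⟨c, v, h⟩ => ⟨c, v.1, v.2, h⟩⟩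

theorem isPauli_pauli (v : PauliVec n) : IsPauli (pauli v) :=
  isPauli_iff.2 ⟨0, v, by rw [pow_zero, one_smul]⟩

theorem IsPauli.I_pow_smul {P : Op n} (hP : IsPauli P) (e : ℕ) :
    IsPauli (Complex.I ^ e • P) := by
  obtain ⟨c, v, rfl⟩ := isPauli_iff.1 hP
  exact isPauli_iff.2 ⟨e + c, v, by rw [smul_smul, pow_add]⟩

theorem IsPauli.I_smul {P : Op n} (hP : IsPauli P) : IsPauli (Complex.I • P) := by
  simpa using hP.I_pow_smul 1

theorem IsPauli.mul {P Q : Op n} (hP : IsPauli P) (hQ : IsPauli Q) : IsPauli (P * Q) := by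
  obtain ⟨c, v, rfl⟩ := isPauli_iff.1 hP
  obtain ⟨d, w, rfl⟩ := isPauli_iff.1 hQ
  obtain ⟨e, he⟩ := exists_sgn_eq_I_pow (v.2 ⬝ᵥ w.1)
  refine isPauli_iff.2 ⟨c + d + e, v + w, ?_⟩
  rw [smul_mul_smul_comm, pauli_mul, he, smul_smul, pow_add, pow_add]

/-- The label of an element of the Pauli group; it determines the element up to a power of `i`. -/
noncomputable def IsPauli.label {P : Op n} (hP : IsPauli P) : PauliVec n :=
  (isPauli_iff.1 hP).choose_spec.choose

theorem IsPauli.exists_eq_smul {P : Op n} (hP : IsPauli P) :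
    ∃ c : ℕ, P = Complex.I ^ c • pauli hP.label :=
  ⟨_, (isPauli_iff.1 hP).choose_spec.choose_spec⟩

theorem pauli_conjTranspose_mul_self (v : PauliVec n) : (pauli v).conjTranspose * pauli v = 1 := by
  rw [pauli_conjTranspose, smul_mul_assoc, pauli_mul_self, smul_smul, sgn_mul_self, one_smul]

theorem IsPauli.conjTranspose_mul_self {P : Op n} (hP : IsPauli P) : P.conjTranspose * P = 1 := by
  obtain ⟨c, v, rfl⟩ := isPauli_iff.1 hP
  rw [Matrix.conjTranspose_smul, smul_mul_smul_comm, pauli_conjTranspose_mul_self, star_pow,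
    ← mul_pow]
  simp

theorem IsPauli.isHermitian_of_mul_self {P : Op n} (hP : IsPauli P) (h : P * P = 1) :
    P.IsHermitian := by
  have := congrArg (· * P) hP.conjTranspose_mul_self
  rwa [mul_assoc, h, mul_one, one_mul] at this

theorem IsPauliObservable.mul_self {P : Op n} (hP : IsPauliObservable P) : P * P = 1 := by
  have := hP.1.conjTranspose_mul_self
  rwa [hP.2.eq] at this

theorem IsPauli.exists_mul_self_eq {P : Op n} (hP : IsPauli P) :
    ∃ e : ℕ, P * P = Complex.I ^ e • 1 := by
  obtain ⟨c, v, rfl⟩ := isPauli_iff.1 hP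
  obtain ⟨e, he⟩ := exists_sgn_eq_I_pow (v.2 ⬝ᵥ v.1)
  exact ⟨c + c + e, by rw [smul_mul_smul_comm, pauli_mul_self, he, smul_smul, pow_add, pow_add]⟩

/-- Every Pauli operator becomes Hermitian after multiplication by a power of `i`. -/
theorem exists_isPauliObservable (v : PauliVec n) :
    ∃ c : ℕ, IsPauliObservable (Complex.I ^ c • pauli v) := by
  rcases zmod_two_cases (v.2 ⬝ᵥ v.1) with h | h
  · refine ⟨0, (isPauli_pauli v).I_pow_smul 0,
      ((isPauli_pauli v).I_pow_smul 0).isHermitian_of_mul_self ?_⟩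
    rw [pow_zero, one_smul, pauli_mul_self, h, sgn_zero, one_smul]
  · refine ⟨1, (isPauli_pauli v).I_pow_smul 1,
      ((isPauli_pauli v).I_pow_smul 1).isHermitian_of_mul_self ?_⟩
    rw [pow_one, smul_mul_smul_comm, pauli_mul_self, h, smul_smul]
    simp

theorem pauli_mul_ne_zero (v w : PauliVec n) : pauli v * pauli w ≠ 0 := by
  intro h
  have h1 := congrArg (fun M => (pauli v).conjTranspose * M) h
  simp only [← mul_assoc, pauli_conjTranspose_mul_self, one_mul, mul_zero] at h1
  have h2 := pauli_conjTranspose_mul_self w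
  rw [h1, mul_zero] at h2
  exact zero_ne_one h2

theorem eq_zero_of_eq_neg_self {M : Op n} (h : M = -M) : M = 0 := by
  have h2 : (2 : ℂ) • M = 0 := by
    rw [two_smul]
    nth_rewrite 1 [h]
    exact neg_add_cancel M
  exact (smul_eq_zero.1 h2).resolve_left two_ne_zero

theorem commute_pauli_iff {v w : PauliVec n} :
    Commute (pauli v) (pauli w) ↔ symp n v w = 0 := by
  constructor
  · intro h
    rcases zmod_two_cases (symp n v w) with h1 | h1
    · exact h1
    · exfalso
      have h2 := pauli_mul_comm v w
      rw [h1, sgn_one, ← h.eq, neg_smul, one_smul] at h2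
      exact pauli_mul_ne_zero v w (eq_zero_of_eq_neg_self h2)
  · intro h
    have h2 := pauli_mul_comm v w
    rwa [h, sgn_zero, one_smul] at h2

theorem symp_eq_zero_of_mem_span {s : Set (PauliVec n)} {u v : PauliVec n}
    (h : ∀ w ∈ s, symp n u w = 0) (hv : v ∈ Submodule.span (ZMod 2) s) : symp n u v = 0 := by
  have : Submodule.span (ZMod 2) s ≤ LinearMap.ker (symp n u) := Submodule.span_le.2 h
  exact this hv

theorem pauli_anticommute {v w : PauliVec n} (h : symp n v w = 1) :
    pauli v * pauli w = -(pauli w * pauli v) := by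
  rw [pauli_mul_comm, h, sgn_one, neg_smul, one_smul]

theorem IsPauli.commute_iff {P Q : Op n} (hP : IsPauli P) (hQ : IsPauli Q) :
    Commute P Q ↔ symp n hP.label hQ.label = 0 := by
  obtain ⟨c, hc⟩ := hP.exists_eq_smul
  obtain ⟨d, hd⟩ := hQ.exists_eq_smul
  rw [← commute_pauli_iff]
  conv_lhs => rw [hc, hd]
  rw [Commute.smul_left_iff₀ (I_pow_ne_zero c), Commute.smul_right_iff₀ (I_pow_ne_zero d)]

theorem IsPauli.symp_label_eq_one {P Q : Op n} (hP : IsPauli P) (hQ : IsPauli Q)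
    (h : P * Q = -(Q * P)) : symp n hP.label hQ.label = 1 := by
  rcases zmod_two_cases (symp n hP.label hQ.label) with h1 | h1
  · exfalso
    have h2 := (hP.commute_iff hQ).2 h1
    rw [h2.eq] at h
    have h3 := eq_zero_of_eq_neg_self h
    have h4 := hQ.conjTranspose_mul_self
    have h5 := hP.conjTranspose_mul_self
    have h6 := congrArg (fun M => Q.conjTranspose * M) h3
    simp only [← mul_assoc, h4, one_mul, mul_zero] at h6
    rw [h6, mul_zero] at h5
    exact zero_ne_one h5
  · exact h1

theorem IsPauli.commute_or_anticommute {P Q : Op n} (hP : IsPauli P) (hQ : IsPauli Q) :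
    Commute P Q ∨ P * Q = -(Q * P) := by
  obtain ⟨c, v, rfl⟩ := isPauli_iff.1 hP
  obtain ⟨d, w, rfl⟩ := isPauli_iff.1 hQ
  rcases zmod_two_cases (symp n v w) with h | h
  · exact Or.inl (((commute_pauli_iff.2 h).smul_left _).smul_right _)
  · right
    rw [smul_mul_smul_comm, smul_mul_smul_comm, pauli_anticommute h, smul_neg, mul_comm]

/-- Linearly independent labels can be assigned arbitrary commutation signs with some Pauli
operator, because the symplectic form is nondegenerate. -/
theorem exists_symp_eq {ι : Type*} {v : ι → PauliVec n} (hv : LinearIndependent (ZMod 2) v)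
    (f : ι → ZMod 2) : ∃ u, ∀ i, symp n u (v i) = f i := by
  obtain ⟨φ, hφ⟩ := LinearMap.exists_extend ((Module.Basis.span hv).constr (ZMod 2) f)
  refine ⟨((symp n).toDual symp_nondegenerate).symm φ, fun i => ?_⟩
  rw [LinearMap.BilinForm.apply_toDual_symm_apply]
  have h1 := (Module.Basis.span hv).constr_basis (ZMod 2) f i
  rw [← hφ, LinearMap.comp_apply, Submodule.subtype_apply, Module.Basis.span_apply] at h1
  exact h1

end PauliGroup

/-! ### Labels of the generators and of the logical operators -/

namespace StabilizerCode

variable {n k : ℕ} (C : StabilizerCode n k)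

/-- The label of a stabilizer generator. -/
noncomputable def genLabel (i : Fin (n - k)) : PauliVec n := (C.isPauli i).label

theorem I_pow_smul_one_mem_stabilizer {e : ℕ} (h : Complex.I ^ e • (1 : Op n) ∈ C.stabilizer) :
    Complex.I ^ e = 1 := by
  have hneg : ∀ c : ℂ, c = -1 → c • (1 : Op n) ∉ C.stabilizer := by
    rintro c rfl
    rw [neg_one_smul]
    exact C.neg_one_notMem
  have hsq : (Complex.I ^ e * Complex.I ^ e) • (1 : Op n) ∈ C.stabilizer := by
    simpa [smul_smul] using mul_mem h h
  have h4 : (Complex.I ^ e) ^ 4 = 1 := by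
    rw [← pow_mul, mul_comm, pow_mul, Complex.I_pow_four, one_pow]
  -- For a root `-1` the scalar itself is excluded, for the roots `±i` its square.
  have h5 : (Complex.I ^ e - 1) *
      ((Complex.I ^ e + 1) * (Complex.I ^ e * Complex.I ^ e + 1)) = 0 := by
    linear_combination h4
  rcases mul_eq_zero.1 h5 with h | h6
  · exact sub_eq_zero.1 h
  · rcases mul_eq_zero.1 h6 with h7 | h7
    · exact absurd h (hneg _ (eq_neg_of_add_eq_zero_left h7))
    · exact absurd hsq (hneg _ (eq_neg_of_add_eq_zero_left h7))

theorem isPauli_of_mem_stabilizer {M : Op n} (hM : M ∈ C.stabilizer) : IsPauli M := by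
  induction hM using Submonoid.closure_induction with
  | mem x hx => obtain ⟨i, rfl⟩ := hx; exact C.isPauli i
  | one => rw [← pauli_zero]; exact isPauli_pauli _
  | mul x y _ _ hx hy => exact hx.mul hy

theorem mul_self_of_mem_stabilizer {M : Op n} (hM : M ∈ C.stabilizer) : M * M = 1 := by
  obtain ⟨e, he⟩ := (C.isPauli_of_mem_stabilizer hM).exists_mul_self_eq
  have h := mul_mem hM hM
  rw [he] at h ⊢
  rw [C.I_pow_smul_one_mem_stabilizer h, one_smul]

theorem gen_mem_stabilizer (i : Fin (n - k)) : C.gen i ∈ C.stabilizer :=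
  Submonoid.subset_closure ⟨i, rfl⟩

theorem gen_mul_self (i : Fin (n - k)) : C.gen i * C.gen i = 1 :=
  C.mul_self_of_mem_stabilizer (C.gen_mem_stabilizer i)

theorem exists_mem_closure_sum_genLabel (T : Finset (Fin (n - k))) :
    ∃ c : ℕ, Complex.I ^ c • pauli (∑ i ∈ T, C.genLabel i) ∈ Submonoid.closure (C.gen '' T) := by
  classical
  induction T using Finset.induction_on with
  | empty => exact ⟨0, by simp⟩
  | insert i T hi ih =>
    obtain ⟨c, hc⟩ := ih
    obtain ⟨d, hd⟩ := (C.isPauli i).exists_eq_smul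
    obtain ⟨e, he⟩ := exists_sgn_eq_I_pow ((C.genLabel i).2 ⬝ᵥ (∑ i ∈ T, C.genLabel i).1)
    refine ⟨d + c + e, ?_⟩
    rw [Finset.coe_insert]
    have h1 : C.gen i ∈ Submonoid.closure (C.gen '' insert i (T : Set (Fin (n - k)))) :=
      Submonoid.subset_closure ⟨i, Set.mem_insert _ _, rfl⟩
    have h2 := mul_mem h1 (Submonoid.closure_mono
      (Set.image_mono (Set.subset_insert i (T : Set (Fin (n - k))))) hc)
    rw [hd, smul_mul_smul_comm, ← genLabel, pauli_mul, he, smul_smul, ← pow_add, ← pow_add,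
      ← Finset.sum_insert hi] at h2
    exact h2

/-- A linear relation between the labels of the generators would express one generator, up to a
phase, by the others; the phase is `1` because the stabilizer group does not contain `-1`. -/
theorem linearIndependent_genLabel : LinearIndependent (ZMod 2) C.genLabel := by
  classical
  rw [Fintype.linearIndependent_iff]
  intro a ha i
  by_contra hi
  have hi1 : a i = 1 := (zmod_two_cases _).resolve_left hi
  set T := (Finset.univ.filter fun j => a j = 1) with hT
  have hsum : ∑ j ∈ T, C.genLabel j = 0 := by
    rw [← ha, hT, Finset.sum_filter]
    refine Finset.sum_congr rfl fun j _ => ?_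
    rcases zmod_two_cases (a j) with h | h <;> simp [h]
  have hiT : i ∈ T := by simp [hT, hi1]
  have hlab : ∑ j ∈ T.erase i, C.genLabel j = C.genLabel i := by
    rw [← Finset.add_sum_erase _ _ hiT] at hsum
    have := congrArg (C.genLabel i + ·) hsum
    simpa only [← add_assoc, add_self_pauliVec, zero_add, add_zero] using this
  obtain ⟨c, hc⟩ := C.exists_mem_closure_sum_genLabel (T.erase i)
  rw [hlab] at hc
  have hc' : Complex.I ^ c • pauli (C.genLabel i) ∈ Submonoid.closure (C.gen '' {i}ᶜ) :=
    Submonoid.closure_mono (Set.image_mono fun j hj => by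
      simp only [Finset.coe_erase] at hj; exact hj.2) hc
  have hstab : Complex.I ^ c • pauli (C.genLabel i) ∈ C.stabilizer :=
    Submonoid.closure_mono (Set.image_subset_range _ _) hc'
  obtain ⟨d, hd⟩ := (C.isPauli i).exists_eq_smul
  have hgen : C.gen i = Complex.I ^ (d + 3 * c) • (Complex.I ^ c • pauli (C.genLabel i)) := by
    rw [smul_smul, pow_add, mul_assoc, I_pow_mul_I_pow_three_mul, mul_one]
    exact hd
  have h1 : Complex.I ^ (d + 3 * c) • (1 : Op n) ∈ C.stabilizer := by
    have := mul_mem (C.gen_mem_stabilizer i) hstab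
    rwa [hgen, smul_mul_assoc, C.mul_self_of_mem_stabilizer hstab] at this
  rw [C.I_pow_smul_one_mem_stabilizer h1, one_smul] at hgen
  exact C.independent i (hgen ▸ hc')

variable {C} (L : C.LogicalBasis)

namespace LogicalBasis

/-- The labels of the logical operators `X_L^(j)` and `Z_L^(j)`. -/
noncomputable def label : Fin k ⊕ Fin k → PauliVec n :=
  Sum.elim (fun j => (L.X_observable j).1.label) fun j => (L.Z_observable j).1.label

/-- The labels of the stabilizer generators and of the logical operators. -/
noncomputable def allLabel : Fin (n - k) ⊕ (Fin k ⊕ Fin k) → PauliVec n :=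
  Sum.elim C.genLabel L.label

theorem symp_genLabel_genLabel (i j : Fin (n - k)) : symp n (C.genLabel i) (C.genLabel j) = 0 :=
  ((C.isPauli i).commute_iff (C.isPauli j)).1 (C.commute i j)

theorem symp_label_genLabel (s : Fin k ⊕ Fin k) (i : Fin (n - k)) :
    symp n (L.label s) (C.genLabel i) = 0 := by
  rcases s with j | j
  · exact ((L.X_observable j).1.commute_iff (C.isPauli i)).1 (L.X_gen j i)
  · exact ((L.Z_observable j).1.commute_iff (C.isPauli i)).1 (L.Z_gen j i)

theorem symp_allLabel_genLabel (s : Fin (n - k) ⊕ (Fin k ⊕ Fin k)) (i : Fin (n - k)) :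
    symp n (L.allLabel s) (C.genLabel i) = 0 := by
  rcases s with j | s
  · exact symp_genLabel_genLabel j i
  · exact L.symp_label_genLabel s i

theorem symp_label_X_X (j l : Fin k) : symp n (L.label (.inl j)) (L.label (.inl l)) = 0 :=
  ((L.X_observable j).1.commute_iff (L.X_observable l).1).1 (L.X_X j l)

theorem symp_label_Z_Z (j l : Fin k) : symp n (L.label (.inr j)) (L.label (.inr l)) = 0 :=
  ((L.Z_observable j).1.commute_iff (L.Z_observable l).1).1 (L.Z_Z j l)

theorem symp_label_X_Z (j l : Fin k) :
    symp n (L.label (.inl j)) (L.label (.inr l)) = if j = l then 1 else 0 := by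
  split_ifs with h
  · subst h
    exact (L.X_observable j).1.symp_label_eq_one (L.Z_observable j).1 (L.X_Z_self j)
  · exact ((L.X_observable j).1.commute_iff (L.Z_observable l).1).1 (L.X_Z_ne j l h)

theorem linearIndependent_allLabel : LinearIndependent (ZMod 2) L.allLabel := by
  rw [Fintype.linearIndependent_iff]
  intro a ha
  have hZ : ∀ j, a (.inr (.inl j)) = 0 := by
    intro j
    have h := congrArg (fun v => symp n v (L.label (.inr j))) ha
    simpa [Fintype.sum_sum_type, allLabel, LinearMap.sum_apply, symp_comm (C.genLabel _),
      symp_label_genLabel, symp_label_X_Z, symp_label_Z_Z] using h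
  have hX : ∀ j, a (.inr (.inr j)) = 0 := by
    intro j
    have h := congrArg (fun v => symp n v (L.label (.inl j))) ha
    simpa [Fintype.sum_sum_type, allLabel, LinearMap.sum_apply, symp_comm (C.genLabel _),
      symp_label_genLabel, symp_comm (L.label (.inr _)) (L.label (.inl j)), symp_label_X_Z,
      symp_label_X_X] using h
  have hG := Fintype.linearIndependent_iff.1 C.linearIndependent_genLabel (fun i => a (.inl i))
    (by simpa [Fintype.sum_sum_type, allLabel, hX, hZ] using ha)
  rintro (i | j | j)
  exacts [hG i, hZ j, hX j]

/-- Only labels of stabilizer elements are orthogonal to all generators and logical operators. -/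
theorem orthogonal_span_allLabel (hk : k < n) :
    (symp n).orthogonal (Submodule.span (ZMod 2) (Set.range L.allLabel)) =
      Submodule.span (ZMod 2) (Set.range C.genLabel) := by
  symm
  refine Submodule.eq_of_le_of_finrank_eq ?_ ?_
  · rw [Submodule.span_le]
    rintro _ ⟨i, rfl⟩
    rw [SetLike.mem_coe, LinearMap.BilinForm.mem_orthogonal_iff]
    intro v hv
    change symp n v (C.genLabel i) = 0
    rw [symp_comm]
    refine symp_eq_zero_of_mem_span ?_ hv
    rintro _ ⟨s, rfl⟩
    rw [symp_comm]
    exact L.symp_allLabel_genLabel s i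
  · rw [LinearMap.BilinForm.finrank_orthogonal symp_nondegenerate,
      finrank_span_eq_card L.linearIndependent_allLabel,
      finrank_span_eq_card C.linearIndependent_genLabel]
    simp only [Module.finrank_prod, Module.finrank_fintype_fun_eq_card, Fintype.card_fin,
      Fintype.card_sum]
    omega

/-- The label of a logical Pauli operator is a sum of labels of generators and of logical
operators of the basis. -/
theorem mem_span_allLabel (hk : k < n) {v : PauliVec n}
    (hv : ∀ i, symp n v (C.genLabel i) = 0) :
    v ∈ Submodule.span (ZMod 2) (Set.range L.allLabel) := by
  rw [← LinearMap.BilinForm.orthogonal_orthogonal symp_nondegenerate symp_isRefl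
    (Submodule.span (ZMod 2) (Set.range L.allLabel)), L.orthogonal_span_allLabel hk,
    LinearMap.BilinForm.mem_orthogonal_iff]
  intro w hw
  change symp n w v = 0
  rw [symp_comm]
  exact symp_eq_zero_of_mem_span (by rintro _ ⟨i, rfl⟩; exact hv i) hw

end LogicalBasis

end StabilizerCode

/-! ### Operators that commute with all logical operators -/

namespace StabilizerCode

variable {n k : ℕ} {C : StabilizerCode n k}

/-- Pauli operators with a label in the span of the generators act on the code space as a phase. -/
theorem exists_pauli_apply_eq_smul {s : PauliVec n}
    (hs : s ∈ Submodule.span (ZMod 2) (Set.range C.genLabel)) :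
    ∃ e : ℕ, ∀ x ∈ C.space, Matrix.toEuclideanLin (pauli s) x = Complex.I ^ e • x := by
  induction hs using Submodule.span_induction with
  | mem s hs =>
    obtain ⟨i, rfl⟩ := hs
    obtain ⟨c, hc⟩ := (C.isPauli i).exists_eq_smul
    refine ⟨3 * c, fun x hx => ?_⟩
    have h := mem_space C |>.1 hx i
    rw [hc, map_smul, LinearMap.smul_apply, ← genLabel] at h
    conv_rhs => rw [← h]
    rw [smul_smul, I_pow_mul_I_pow_three_mul, one_smul]
  | zero => exact ⟨0, fun x _ => by rw [pauli_zero, toEuclideanLin_one_apply, pow_zero, one_smul]⟩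
  | add s t _ _ hs ht =>
    obtain ⟨d, hd⟩ := hs
    obtain ⟨e, he⟩ := ht
    obtain ⟨f, hf⟩ := exists_sgn_eq_I_pow (s.2 ⬝ᵥ t.1)
    refine ⟨f + e + d, fun x hx => ?_⟩
    rw [pauli_add, hf, map_smul, LinearMap.smul_apply, toEuclideanLin_mul_apply, he x hx, map_smul,
      hd x hx, smul_smul, smul_smul, pow_add, pow_add]
  | smul c s _ hs =>
    rcases zmod_two_cases c with rfl | rfl
    · exact ⟨0, fun x _ => by
        rw [zero_smul, pauli_zero, toEuclideanLin_one_apply, pow_zero, one_smul]⟩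
    · simpa using hs

theorem sum_sgn_symp_eq_zero {W : Submodule (ZMod 2) (PauliVec n)} [Fintype W] {p : PauliVec n}
    (hp : p ∉ (symp n).orthogonal W) : ∑ w : W, sgn (symp n p w) = 0 := by
  rw [LinearMap.BilinForm.mem_orthogonal_iff] at hp
  push Not at hp
  obtain ⟨w₀, hw₀, h⟩ := hp
  have h1 : symp n p w₀ = 1 := by
    rw [symp_comm]
    exact (zmod_two_cases _).resolve_left h
  have h2 := Equiv.sum_comp (Equiv.addRight (⟨w₀, hw₀⟩ : W)) fun w : W => sgn (symp n p w)
  simp only [Equiv.coe_addRight, Submodule.coe_add, map_add, sgn_add, h1, sgn_one, mul_neg,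
    mul_one, Finset.sum_neg_distrib] at h2
  linear_combination (-1 / 2 : ℂ) * h2

/-- Averaging an operator over conjugation by the Pauli operators with labels in
`W` leaves only the Pauli components with labels in the orthogonal complement of `W`. -/
theorem exists_sum_conj_apply_eq_smul {W : Submodule (ZMod 2) (PauliVec n)} [Fintype W]
    (hW : (symp n).orthogonal W = Submodule.span (ZMod 2) (Set.range C.genLabel)) (M : Op n) :
    ∃ c : ℂ, ∀ x ∈ C.space,
      Matrix.toEuclideanLin (∑ w : W, (pauli (w : PauliVec n)).conjTranspose * M * pauli w) x =
        c • x := by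
  have hM : M ∈ Submodule.span ℂ (Set.range (pauli (n := n))) := span_pauli ▸ Submodule.mem_top
  induction hM using Submodule.span_induction with
  | mem M hM =>
    obtain ⟨p, rfl⟩ := hM
    have h : ∀ w : W, (pauli (w : PauliVec n)).conjTranspose * pauli p * pauli w =
        sgn (symp n p w) • pauli p := by
      intro w
      rw [mul_assoc, pauli_mul_comm, mul_smul_comm, ← mul_assoc, pauli_conjTranspose_mul_self,
        one_mul]
    simp only [h, ← Finset.sum_smul]
    by_cases hp : p ∈ (symp n).orthogonal W
    · rw [hW] at hp
      obtain ⟨e, he⟩ := exists_pauli_apply_eq_smul hp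
      exact ⟨_, fun x hx => by rw [map_smul, LinearMap.smul_apply, he x hx, smul_smul]⟩
    · exact ⟨0, fun x _ => by
        rw [sum_sgn_symp_eq_zero hp, zero_smul, zero_smul, map_zero, LinearMap.zero_apply]⟩
  | zero => exact ⟨0, fun x _ => by simp⟩
  | add M N _ _ hM hN =>
    obtain ⟨c, hc⟩ := hM
    obtain ⟨d, hd⟩ := hN
    refine ⟨c + d, fun x hx => ?_⟩
    simp only [mul_add, add_mul, Finset.sum_add_distrib]
    rw [map_add, LinearMap.add_apply, hc x hx, hd x hx, add_smul]
  | smul a M _ hM =>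
    obtain ⟨c, hc⟩ := hM
    refine ⟨a * c, fun x hx => ?_⟩
    simp only [mul_smul_comm, smul_mul_assoc, ← Finset.smul_sum]
    rw [map_smul, LinearMap.smul_apply, hc x hx, smul_smul]

@[simp] theorem coe_act {P : Op n} (hP : C.IsLogicalPauli P) (x : C.space) :
    (C.act hP x : Qubits n) = Matrix.toEuclideanLin P x := rfl

namespace LogicalBasis

variable (L : C.LogicalBasis)

theorem isLogicalPauli_X (j : Fin k) : C.IsLogicalPauli (L.X j) :=
  ⟨(L.X_observable j).1, L.X_gen j⟩

theorem isLogicalPauli_Z (j : Fin k) : C.IsLogicalPauli (L.Z j) :=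
  ⟨(L.Z_observable j).1, L.Z_gen j⟩

/-- The operators on the code space that commute with all logical operators are scalars: extended
to all `n` qubits, such an operator agrees on the code space with its average under conjugation by
the logical Pauli operators, which is a combination of stabilizer elements there. -/
theorem exists_eq_smul_one (hk : k < n) (T : Module.End ℂ C.space)
    (hX : ∀ j, Commute T (C.act (L.isLogicalPauli_X j)))
    (hZ : ∀ j, Commute T (C.act (L.isLogicalPauli_Z j))) : ∃ c : ℂ, T = c • 1 := by
  obtain ⟨T', hT'⟩ := LinearMap.exists_extend (C.space.subtype ∘ₗ T)
  obtain ⟨M, rfl⟩ := Matrix.toEuclideanLin.surjective T'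
  have hM : ∀ x : C.space, Matrix.toEuclideanLin M x = (T x : Qubits n) := fun x =>
    LinearMap.congr_fun hT' x
  have hT : ∀ {P : Op n} (hP : C.IsLogicalPauli P), Commute T (C.act hP) →
      ∀ {v : PauliVec n} {c : ℕ}, P = Complex.I ^ c • pauli v → ∀ x ∈ C.space,
      Matrix.toEuclideanLin (pauli v) x ∈ C.space ∧
        Matrix.toEuclideanLin M (Matrix.toEuclideanLin (pauli v) x) =
          Matrix.toEuclideanLin (pauli v) (Matrix.toEuclideanLin M x) := by
    intro P hP hTP v c hPv x hx
    have hv : pauli v = Complex.I ^ (3 * c) • P := by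
      rw [hPv, smul_smul, I_pow_mul_I_pow_three_mul, one_smul]
    have hPx := hP.mapsTo x hx
    refine ⟨?_, ?_⟩
    · rw [hv, map_smul, LinearMap.smul_apply]
      exact C.space.smul_mem _ hPx
    · have h1 := congrArg (Subtype.val) (LinearMap.congr_fun hTP.eq ⟨x, hx⟩)
      rw [Module.End.mul_apply, Module.End.mul_apply, coe_act, ← hM, ← hM, coe_act] at h1
      rw [hv, map_smul, LinearMap.smul_apply, LinearMap.smul_apply, map_smul, h1]
  set W := Submodule.span (ZMod 2) (Set.range L.allLabel) with hWdef
  have hW : ∀ w ∈ W, ∀ x ∈ C.space, Matrix.toEuclideanLin (pauli w) x ∈ C.space ∧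
      Matrix.toEuclideanLin M (Matrix.toEuclideanLin (pauli w) x) =
        Matrix.toEuclideanLin (pauli w) (Matrix.toEuclideanLin M x) := by
    intro w hw
    induction hw using Submodule.span_induction with
    | mem w hw =>
      obtain ⟨i | j | j, rfl⟩ := hw
      · intro x hx
        obtain ⟨e, he⟩ := exists_pauli_apply_eq_smul
          (Submodule.subset_span (Set.mem_range_self (f := C.genLabel) i))
        have h1 : Matrix.toEuclideanLin M x ∈ C.space := by
          rw [hM ⟨x, hx⟩]; exact (T ⟨x, hx⟩).2
        change Matrix.toEuclideanLin (pauli (C.genLabel i)) x ∈ C.space ∧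
          Matrix.toEuclideanLin M (Matrix.toEuclideanLin (pauli (C.genLabel i)) x) =
            Matrix.toEuclideanLin (pauli (C.genLabel i)) (Matrix.toEuclideanLin M x)
        rw [he x hx, he _ h1, map_smul]
        exact ⟨C.space.smul_mem _ hx, rfl⟩
      · obtain ⟨c, hc⟩ := (L.X_observable j).1.exists_eq_smul
        exact hT _ (hX j) hc
      · obtain ⟨c, hc⟩ := (L.Z_observable j).1.exists_eq_smul
        exact hT _ (hZ j) hc
    | zero =>
      intro x hx
      simp only [pauli_zero, toEuclideanLin_one_apply, hx, and_self]
    | add v w _ _ hv hw =>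
      intro x hx
      obtain ⟨h1, h2⟩ := hw x hx
      obtain ⟨h3, h4⟩ := hv _ h1
      simp only [pauli_add, map_smul, LinearMap.smul_apply, toEuclideanLin_mul_apply, h4, h2]
      exact ⟨C.space.smul_mem _ h3, trivial⟩
    | smul c w _ hw =>
      intro x hx
      rcases zmod_two_cases c with rfl | rfl
      · simp only [zero_smul, pauli_zero, toEuclideanLin_one_apply, hx, and_self]
      · rw [one_smul]; exact hw x hx
  have : Fintype W := Fintype.ofFinite W
  obtain ⟨c, hc⟩ := exists_sum_conj_apply_eq_smul (L.orthogonal_span_allLabel hk) M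
  have hcard : (Fintype.card W : ℂ) ≠ 0 := Nat.cast_ne_zero.2 Fintype.card_ne_zero
  refine ⟨(Fintype.card W : ℂ)⁻¹ * c, LinearMap.ext fun x => Subtype.ext ?_⟩
  have h1 := hc x x.2
  rw [map_sum, LinearMap.sum_apply] at h1
  have h2 : ∀ w : W, Matrix.toEuclideanLin ((pauli (w : PauliVec n)).conjTranspose * M * pauli w)
      (x : Qubits n) = (T x : Qubits n) := by
    intro w
    rw [toEuclideanLin_mul_apply, toEuclideanLin_mul_apply, (hW w w.2 x x.2).2,
      ← toEuclideanLin_mul_apply, pauli_conjTranspose_mul_self, toEuclideanLin_one_apply, hM]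
  rw [Finset.sum_congr rfl fun w _ => h2 w, Finset.sum_const, Finset.card_univ,
    ← Nat.cast_smul_eq_nsmul ℂ] at h1
  change (T x : Qubits n) = ((Fintype.card W : ℂ)⁻¹ * c) • (x : Qubits n)
  rw [mul_smul, ← h1, smul_smul, inv_mul_cancel₀ hcard, one_smul]

end LogicalBasis

end StabilizerCode

/-! ### The effect of an elementary code rewiring -/

section Run

variable {n : ℕ}

theorem Step.branch_apply {p : Step n} (h : p.corr * p.obs = -(p.obs * p.corr)) {x : Qubits n}
    (hx : Matrix.toEuclideanLin p.corr x = x) (b : Bool) :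
    Matrix.toEuclideanLin (p.branch b) x =
      (1 / 2 : ℂ) • (x + Matrix.toEuclideanLin p.obs x) := by
  cases b with
  | false =>
    rw [Step.branch, map_smul, map_add, LinearMap.smul_apply, LinearMap.add_apply,
      toEuclideanLin_one_apply]
  | true =>
    rw [Step.branch, mul_smul_comm, mul_sub, mul_one, h, sub_neg_eq_add, map_smul, map_add,
      LinearMap.smul_apply, LinearMap.add_apply, toEuclideanLin_mul_apply, hx]

theorem run_append (xs ys : List (Step n × Bool)) : run (xs ++ ys) = run ys * run xs := by
  induction xs with
  | nil => simp [run]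
  | cons x xs ih => rw [List.cons_append, run, ih, run, mul_assoc]

end Run

namespace StabilizerCode

variable {n k : ℕ} {C : StabilizerCode n k} {L : C.LogicalBasis}

/-- Whatever the outcomes, an elementary code rewiring acts on the code space as a multiple of
`1 + g' g`. -/
theorem ElementaryRewiring.run_apply (r : C.ElementaryRewiring L) {outcomes : List Bool}
    (hlen : outcomes.length = r.steps.length) (x : C.space) :
    Matrix.toEuclideanLin (run (r.steps.zip outcomes)) (x : Qubits n) =
      (1 / 4 : ℂ) • ((x : Qubits n) + Matrix.toEuclideanLin (r.g' * r.g) (x : Qubits n)) := by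
  obtain ⟨a, b, c, rfl⟩ := List.length_eq_three.1 hlen
  have hG := mem_space C |>.1 x.2 r.m
  have hgG : r.g * C.gen r.m = -(C.gen r.m * r.g) := r.isPair.anticommute_gen
  have hgG' : r.g' * C.gen r.m = -(C.gen r.m * r.g') := r.isPair.anticommute_gen'
  have hgg : r.g * r.g' = -(r.g' * r.g) := r.isPair.anticommute
  have hg2 := r.isPair.observable.mul_self
  have hg2' := r.isPair.observable'.mul_self
  have app : ∀ {M N K : Op n}, M * N = K → ∀ y : Qubits n,
      Matrix.toEuclideanLin M (Matrix.toEuclideanLin N y) = Matrix.toEuclideanLin K y := by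
    rintro M N _ rfl y
    rw [toEuclideanLin_mul_apply]
  simp only [ElementaryRewiring.steps, List.zip_cons_cons, List.zip_nil_right, run, one_mul,
    toEuclideanLin_mul_apply]
  rw [Step.branch_apply (p := ⟨r.g, C.gen r.m⟩) (by simp only [hgG, neg_neg]) hG,
    Step.branch_apply (p := ⟨r.g', r.g⟩) hgg, Step.branch_apply (p := ⟨C.gen r.m, r.g'⟩) hgG']
  · have h1 : Matrix.toEuclideanLin (C.gen r.m) (Matrix.toEuclideanLin r.g (x : Qubits n)) =
        -Matrix.toEuclideanLin r.g (x : Qubits n) := by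
      conv_rhs => rw [← hG]
      rw [app rfl, app hgG, map_neg, LinearMap.neg_apply, neg_neg]
    have h2 : ∀ y, Matrix.toEuclideanLin (C.gen r.m) (Matrix.toEuclideanLin r.g' y) =
        -Matrix.toEuclideanLin r.g' (Matrix.toEuclideanLin (C.gen r.m) y) := by
      intro y
      rw [app rfl, app hgG', map_neg, LinearMap.neg_apply, neg_neg]
    simp only [map_smul, map_add, h1, h2, hG, map_neg]
    module
  · simp only [map_smul, map_add, app hg2', toEuclideanLin_one_apply]
    rw [add_comm]
  · simp only [map_smul, map_add, app hg2, toEuclideanLin_one_apply]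
    rw [add_comm]

/-! ### Rewirings realize all rotations about logical observables -/

/-- The operators on the code space that are given by logical Pauli operators and square to `1`. -/
def logicalObservables (C : StabilizerCode n k) : Set (Module.End ℂ C.space) :=
  {T | T * T = 1 ∧ ∃ (P : Op n) (hP : C.IsLogicalPauli P), T = C.act hP}

theorem IsLogicalPauli.mul {P Q : Op n} (hP : C.IsLogicalPauli P) (hQ : C.IsLogicalPauli Q) :
    C.IsLogicalPauli (P * Q) :=
  ⟨hP.1.mul hQ.1, fun i => (hP.2 i).mul_left (hQ.2 i)⟩

theorem IsLogicalPauli.I_smul {P : Op n} (hP : C.IsLogicalPauli P) :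
    C.IsLogicalPauli (Complex.I • P) :=
  ⟨hP.1.I_smul, fun i => (hP.2 i).smul_left _⟩

theorem act_mul {P Q : Op n} (hP : C.IsLogicalPauli P) (hQ : C.IsLogicalPauli Q) :
    C.act hP * C.act hQ = C.act (hP.mul hQ) :=
  LinearMap.ext fun x => Subtype.ext (toEuclideanLin_mul_apply P Q x).symm

theorem act_I_smul {P : Op n} (hP : C.IsLogicalPauli P) :
    Complex.I • C.act hP = C.act hP.I_smul :=
  LinearMap.ext fun x => Subtype.ext (by
    rw [coe_act, map_smul, LinearMap.smul_apply]; rfl)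

theorem isPauliFamily_logicalObservables : IsPauliFamily C.logicalObservables where
  mul_self := fun T hT => hT.1
  commute_or := by
    rintro _ ⟨-, P, hP, rfl⟩ _ ⟨-, Q, hQ, rfl⟩
    have h : ∀ (M N : Op n) (x : C.space), Matrix.toEuclideanLin M
        (Matrix.toEuclideanLin N (x : Qubits n)) = Matrix.toEuclideanLin (M * N) x :=
      fun M N x => (toEuclideanLin_mul_apply M N x).symm
    refine (hP.1.commute_or_anticommute hQ.1).imp (fun hPQ => ?_) fun hPQ => ?_
    · refine LinearMap.ext fun x => Subtype.ext ?_
      change Matrix.toEuclideanLin P (Matrix.toEuclideanLin Q (x : Qubits n)) =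
        Matrix.toEuclideanLin Q (Matrix.toEuclideanLin P (x : Qubits n))
      rw [h, h, hPQ.eq]
    · refine LinearMap.ext fun x => Subtype.ext ?_
      change Matrix.toEuclideanLin P (Matrix.toEuclideanLin Q (x : Qubits n)) =
        -Matrix.toEuclideanLin Q (Matrix.toEuclideanLin P (x : Qubits n))
      rw [h, h, hPQ, map_neg, LinearMap.neg_apply]
  mul_mem := by
    rintro S ⟨hS, P, hP, hSP⟩ T ⟨hT, Q, hQ, hTQ⟩ hST
    refine ⟨?_, P * Q, hP.mul hQ, by rw [hSP, hTQ, act_mul]⟩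
    rw [mul_assoc, ← mul_assoc T S T, ← hST.eq, mul_assoc S T T, hT, mul_one, hS]
  I_smul_mul_mem := by
    rintro S ⟨hS, P, hP, hSP⟩ T ⟨hT, Q, hQ, hTQ⟩ hST
    refine ⟨?_, _, (hP.mul hQ).I_smul, by rw [hSP, hTQ, act_mul, act_I_smul]⟩
    rw [smul_mul_smul_comm, Complex.I_mul_I, mul_mul_self_of_anticommute hS hT hST, neg_one_smul,
      neg_neg]

theorem act_mem_logicalObservables {P : Op n} (hP : C.IsLogicalPauli P)
    (h : IsPauliObservable P) : C.act hP ∈ C.logicalObservables := by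
  refine ⟨LinearMap.ext fun x => Subtype.ext ?_, P, hP, rfl⟩
  change Matrix.toEuclideanLin P (Matrix.toEuclideanLin P (x : Qubits n)) = x
  rw [← toEuclideanLin_mul_apply, h.mul_self, toEuclideanLin_one_apply]

theorem isQubitFrame_act (hk : k < n) (L : C.LogicalBasis) :
    IsQubitFrame C.logicalObservables (fun j => C.act (L.isLogicalPauli_X j))
      fun j => C.act (L.isLogicalPauli_Z j) := by
  have comm : ∀ {P Q : Op n} (hP : C.IsLogicalPauli P) (hQ : C.IsLogicalPauli Q), Commute P Q →
      Commute (C.act hP) (C.act hQ) := by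
    intro P Q hP hQ h
    change _ * _ = _ * _
    rw [act_mul, act_mul]
    congr 1
  exact
  { X_mem := fun j => act_mem_logicalObservables _ (L.X_observable j)
    Z_mem := fun j => act_mem_logicalObservables _ (L.Z_observable j)
    X_X := fun j l => comm _ _ (L.X_X j l)
    Z_Z := fun j l => comm _ _ (L.Z_Z j l)
    X_Z_ne := fun j l h => comm _ _ (L.X_Z_ne j l h)
    X_Z_self := fun j => LinearMap.ext fun x => Subtype.ext (by
      have h : L.X j * L.Z j = -(L.Z j * L.X j) := L.X_Z_self j
      change Matrix.toEuclideanLin (L.X j) (Matrix.toEuclideanLin (L.Z j) (x : Qubits n)) =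
        -Matrix.toEuclideanLin (L.Z j) (Matrix.toEuclideanLin (L.X j) (x : Qubits n))
      rw [← toEuclideanLin_mul_apply, h, map_neg, LinearMap.neg_apply, toEuclideanLin_mul_apply])
    scalar := L.exists_eq_smul_one hk }

namespace LogicalBasis

/-- A logical observable is represented by a Hermitian Pauli operator whose label is a sum of
labels of the logical operators `X_L^(j)`, `Z_L^(j)`. -/
theorem exists_representative [Nontrivial C.space] (hk : k < n) (L : C.LogicalBasis)
    {T : Module.End ℂ C.space} (hT : T ∈ C.logicalObservables) :
    ∃ (e : ℕ) (f : PauliVec n), f ∈ Submodule.span (ZMod 2) (Set.range L.label) ∧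
      IsPauliObservable (Complex.I ^ e • pauli f) ∧
      ∀ x : C.space, (T x : Qubits n) = Matrix.toEuclideanLin (Complex.I ^ e • pauli f) x := by
  obtain ⟨hTT, P, hP, rfl⟩ := hT
  obtain ⟨c, hc⟩ := hP.1.exists_eq_smul
  have hmem := L.mem_span_allLabel hk fun i => (hP.1.commute_iff (C.isPauli i)).1 (hP.2 i)
  rw [allLabel, Set.Sum.elim_range, Submodule.span_union] at hmem
  obtain ⟨s, hs, f, hf, hsf⟩ := Submodule.mem_sup.1 hmem
  obtain ⟨d, hd⟩ := exists_pauli_apply_eq_smul hs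
  obtain ⟨a, ha⟩ := exists_sgn_eq_I_pow (f.2 ⬝ᵥ s.1)
  have hrep : ∀ x : C.space, (C.act hP x : Qubits n) =
      Matrix.toEuclideanLin (Complex.I ^ (c + a + d) • pauli f) x := by
    intro x
    rw [coe_act, hc, ← hsf, add_comm s f, pauli_add, ha, smul_smul, map_smul, LinearMap.smul_apply,
      toEuclideanLin_mul_apply, hd x x.2, map_smul, map_smul, LinearMap.smul_apply, smul_smul,
      ← pow_add, ← pow_add]
  have hR := (isPauli_pauli f).I_pow_smul (c + a + d)
  refine ⟨c + a + d, f, hf, ⟨hR, hR.isHermitian_of_mul_self ?_⟩, hrep⟩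
  obtain ⟨b, hb⟩ := hR.exists_mul_self_eq
  obtain ⟨x, hx⟩ := exists_ne (0 : C.space)
  have h1 := congrArg Subtype.val (LinearMap.congr_fun hTT x)
  rw [Module.End.mul_apply, hrep, hrep, ← toEuclideanLin_mul_apply, hb, map_smul,
    LinearMap.smul_apply, toEuclideanLin_one_apply, Module.End.one_apply] at h1
  have h2 : (Complex.I ^ b - 1) • (x : Qubits n) = 0 := by
    rw [sub_smul, h1, one_smul, sub_self]
  have h3 := (smul_eq_zero.1 h2).resolve_right (by simpa using hx)
  rw [hb, sub_eq_zero.1 h3, one_smul]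

/-- For each logical observable `T` there is an elementary code rewiring with the effect of
the rotation `1 + i T`. If `R` represents `T` and commutes with `g`, then `R g_m` also represents
`T` but anticommutes with `g`, so `g' = i R g_m g` completes a rewiring pair with
`g' g = i R g_m`. -/
theorem exists_elementaryRewiring [Nontrivial C.space] (hk : k < n) (L : C.LogicalBasis)
    {T : Module.End ℂ C.space} (hT : T ∈ C.logicalObservables) :
    ∃ r : C.ElementaryRewiring L, ∀ outcomes : List Bool, outcomes.length = r.steps.length →
      ∀ x : C.space, Matrix.toEuclideanLin (run (r.steps.zip outcomes)) (x : Qubits n) =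
        (1 / 4 : ℂ) • (((1 + Complex.I • T) x : C.space) : Qubits n) := by
  classical
  obtain ⟨e, f, hf, hR, hrep⟩ := L.exists_representative hk hT
  set R := Complex.I ^ e • pauli f with hRdef
  let m : Fin (n - k) := ⟨0, by omega⟩
  obtain ⟨u, hu⟩ := exists_symp_eq L.linearIndependent_allLabel (Pi.single (.inl m) 1)
  obtain ⟨a, hg⟩ := exists_isPauliObservable u
  set g := Complex.I ^ a • pauli u with hgdef
  set G := C.gen m with hGdef
  have hcomm : ∀ {v w : PauliVec n} {c d : ℂ}, symp n v w = 0 →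
      Commute (c • pauli v) (d • pauli w) := fun h =>
    ((commute_pauli_iff.2 h).smul_left _).smul_right _
  have hanti : ∀ {v w : PauliVec n} {c d : ℂ}, symp n v w = 1 →
      c • pauli v * d • pauli w = -(d • pauli w * c • pauli v) := fun h => by
    rw [smul_mul_smul_comm, smul_mul_smul_comm, pauli_anticommute h, smul_neg, mul_comm]
  have hg_gen : ∀ j, j ≠ m → Commute g (C.gen j) := by
    intro j hj
    obtain ⟨c, hc⟩ := (C.isPauli j).exists_eq_smul
    rw [hc]
    refine hcomm ((hu (.inl j)).trans ?_)
    exact Pi.single_eq_of_ne (by simpa using hj) _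
  have hgG : g * G = -(G * g) := by
    obtain ⟨c, hc⟩ := (C.isPauli m).exists_eq_smul
    rw [hGdef, hc]
    exact hanti ((hu (.inl m)).trans (Pi.single_eq_same _ _))
  have hu_label : ∀ s, symp n u (L.label s) = 0 := fun s =>
    (hu (.inr s)).trans (Pi.single_eq_of_ne (by simp) _)
  have hg_X : ∀ j, Commute g (L.X j) := by
    intro j
    obtain ⟨c, hc⟩ := (L.X_observable j).1.exists_eq_smul
    rw [hc]
    exact hcomm (hu_label (.inl j))
  have hg_Z : ∀ j, Commute g (L.Z j) := by
    intro j
    obtain ⟨c, hc⟩ := (L.Z_observable j).1.exists_eq_smul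
    rw [hc]
    exact hcomm (hu_label (.inr j))
  have hgR : Commute g R :=
    hcomm (symp_eq_zero_of_mem_span (by rintro _ ⟨s, rfl⟩; exact hu_label s) hf)
  have hR_gen : ∀ j, Commute R (C.gen j) := by
    intro j
    obtain ⟨c, hc⟩ := (C.isPauli j).exists_eq_smul
    rw [hc]
    refine hcomm ((symp_comm _ _).trans (symp_eq_zero_of_mem_span ?_ hf))
    rintro _ ⟨s, rfl⟩
    exact (symp_comm _ _).trans (L.symp_label_genLabel s j)
  have hgg := hg.mul_self
  have hGG : G * G = 1 := C.gen_mul_self m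
  have hRG : R * G = G * R := (hR_gen m).eq
  have hgRG : g * (R * G) = -(R * G * g) := by
    rw [← mul_assoc, hgR.eq, mul_assoc, hgG, mul_neg, mul_assoc]
  have hRGRG : R * G * (R * G) = 1 := by
    nth_rewrite 2 [hRG]
    rw [mul_assoc, ← mul_assoc G G R, hGG, one_mul, hR.mul_self]
  have hg'g : Complex.I • (R * G * g) * g = Complex.I • (R * G) := by
    rw [smul_mul_assoc, mul_assoc, hgg, mul_one]
  have hgg' : g * Complex.I • (R * G * g) = -(Complex.I • (R * G * g) * g) := by
    rw [mul_smul_comm, smul_mul_assoc Complex.I (R * G * g) g, ← mul_assoc, hgRG, neg_mul, smul_neg]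
  have hpauli' : IsPauli (Complex.I • (R * G * g)) := ((hR.1.mul (C.isPauli m)).mul hg.1).I_smul
  have hpair : C.IsRewiringPair L m g (Complex.I • (R * G * g)) :=
    { observable := hg
      observable' := ⟨hpauli', hpauli'.isHermitian_of_mul_self (by
        rw [smul_mul_smul_comm, Complex.I_mul_I,
          mul_mul_self_of_anticommute hRGRG hgg (anticommute_symm hgRG), neg_one_smul, neg_neg])⟩
      commute_gen := hg_gen
      anticommute_gen := hgG
      commute_X := hg_X
      commute_Z := hg_Z
      commute_gen' := fun j hj =>
        (((hR_gen j).mul_left (C.commute m j)).mul_left (hg_gen j hj)).smul_left _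
      anticommute_gen' := smul_anticommute _
        (commute_mul_anticommute (Commute.mul_left (hR_gen m) (Commute.refl G)) hgG)
      anticommute := hgg' }
  refine ⟨⟨m, g, _, hpair⟩, fun outcomes hlen x => ?_⟩
  rw [ElementaryRewiring.run_apply _ hlen, hg'g, map_smul, LinearMap.smul_apply,
    toEuclideanLin_mul_apply, mem_space C |>.1 x.2 m, ← hrep x]
  rfl

end LogicalBasis

/-- A sequence of elementary code rewirings has the effect of `T` on the code space, up to a
nonzero scalar that may depend on the measurement outcomes. -/
def Inducible (L : C.LogicalBasis) (T : Module.End ℂ C.space) : Prop :=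
  ∃ rs : List (C.ElementaryRewiring L), ∀ outcomes : List Bool,
    outcomes.length = (rs.flatMap fun r => r.steps).length →
    ∃ z : ℂ, z ≠ 0 ∧ ∀ x : C.space,
      Matrix.toEuclideanLin (run ((rs.flatMap fun r => r.steps).zip outcomes)) (x : Qubits n) =
        z • (T x : Qubits n)

theorem inducible_one : Inducible L 1 := by
  refine ⟨[], fun outcomes _ => ⟨1, one_ne_zero, fun x => ?_⟩⟩
  simp [run]

theorem Inducible.smul {T : Module.End ℂ C.space} (hT : Inducible L T) {c : ℂ} (hc : c ≠ 0) :
    Inducible L (c • T) := by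
  obtain ⟨rs, h⟩ := hT
  refine ⟨rs, fun outcomes hlen => ?_⟩
  obtain ⟨z, hz, h⟩ := h outcomes hlen
  refine ⟨z * c⁻¹, mul_ne_zero hz (inv_ne_zero hc), fun x => ?_⟩
  rw [h, LinearMap.smul_apply, Submodule.coe_smul, smul_smul, mul_assoc, inv_mul_cancel₀ hc,
    mul_one]

theorem Inducible.rotation_mul [Nontrivial C.space] (hk : k < n) {P T : Module.End ℂ C.space}
    (hP : P ∈ C.logicalObservables) (hT : Inducible L T) :
    Inducible L ((1 + Complex.I • P) * T) := by
  obtain ⟨rs, h⟩ := hT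
  obtain ⟨r, hr⟩ := L.exists_elementaryRewiring hk hP
  refine ⟨rs ++ [r], fun outcomes hlen => ?_⟩
  simp only [List.flatMap_append, List.flatMap_cons, List.flatMap_nil, List.append_nil,
    List.length_append] at hlen ⊢
  set ps := rs.flatMap fun r => r.steps
  have h1 : (outcomes.take ps.length).length = ps.length := by simp [hlen]
  have h2 : (outcomes.drop ps.length).length = r.steps.length := by simp [hlen]
  obtain ⟨z, hz, h⟩ := h _ h1
  refine ⟨z * (1 / 4), mul_ne_zero hz (by norm_num), fun x => ?_⟩
  rw [← List.take_append_drop ps.length outcomes, List.zip_append h1.symm, run_append,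
    toEuclideanLin_mul_apply, h, map_smul, hr _ h2, smul_smul]
  rfl

/-- Every logical Clifford operator is induced by a sequence of elementary code rewirings. -/
theorem IsClifford.exists_induces (hk : k < n) (L : C.LogicalBasis)
    {U : C.space ≃ₗᵢ[ℂ] C.space} (hU : C.IsClifford U) :
    ∃ rs : List (C.ElementaryRewiring L), C.Induces (rs.flatMap fun r => r.steps) U := by
  rcases subsingleton_or_nontrivial C.space with hsub | hnt
  · refine ⟨[], fun outcomes _ => ⟨1, one_ne_zero, fun v => ?_⟩⟩
    rw [Subsingleton.elim (U v) 0, Subsingleton.elim v 0]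
    simp
  let V : (Module.End ℂ C.space)ˣ :=
    ⟨U.toLinearEquiv.toLinearMap, U.symm.toLinearEquiv.toLinearMap,
      LinearMap.ext fun x => U.apply_symm_apply x, LinearMap.ext fun x => U.symm_apply_apply x⟩
  refine (isQubitFrame_act hk L).induction_clifford (Ind := Inducible L)
    isPauliFamily_logicalObservables inducible_one (fun c T hc hT => hT.smul hc)
    (fun P hP T hT => hT.rotation_mul hk hP) V ?_
  rintro _ ⟨hPP, P, hP, rfl⟩
  refine ⟨?_, ?_⟩
  · rw [units_conj_mul, hPP, mul_one, Units.mul_inv]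
  · obtain ⟨Q, hQ, h⟩ := hU P hP
    exact ⟨Q, hQ, LinearMap.ext h⟩

end StabilizerCode

end CodeRewiring

theorem theorem1 {n k : ℕ} (hk : k < n) (d : ℕ∞)
    (C : CodeRewiring.StabilizerCode n k) (hd : C.distance = d) (L : C.LogicalBasis)
    (U : C.space ≃ₗᵢ[ℂ] C.space) (hU : C.IsClifford U) :
    ∃ rs : List (C.ElementaryRewiring L), C.Induces (rs.flatMap fun r => r.steps) U :=
  hU.exists_induces hk L
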